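/- Let $\mathcal{H}$ be the free commutative unital $\mathbb{Q}$-algebra generated by the isomorphism classes of (finite, non-planar) rooted trees. Its monomials are the rooted forests (the product is disjoint union), with the empty forest $\mathbb{I}$ as unit. Let $\bullet$ be the tree with one vertex, and let $B_+:\mathcal{H}\to\mathcal{H}$ be the $\mathbb{Q}$-linear grafting operator that sends a forest $t_1\cdots t_n$ to the tree obtained by connecting the roots of $t_1,\dots,t_n$ to a new root, so that $B_+(\mathbb{I})=\bullet$. The coproduct $\Delta:\mathcal{H}\to\mathcal{H}\otimes\mathcal{H}$ is the algebra homomorphism with $\Delta(t)=t\otimes\mathbb{I}+(\mathrm{id}\otimes B_+)(\Delta(f))$ for every tree $t=B_+(f)$. Let $\mathfrak{H}=\mathbb{Q}\langle x,y\rangle$ be the noncommutative polynomial ring. The rooted tree maps $\tilde f:\mathfrak{H}\to\mathfrak{H}$, $f\in\mathcal{H}$, are the $\mathbb{Q}$-linear maps, depending $\mathbb{Q}$-linearly on $f$, that are uniquely determined by the following conditions: - $\tilde{\mathbb{I}}=\mathrm{id}$ and $\tilde{\bullet}(x)=-\tilde{\bullet}(y)=xy$; - if $f\neq\mathbb{I}$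 is a forest, then $\tilde f(x)=uy$ for some $u\in\mathfrak{H}$, and $\widetilde{B_+(f)}(x)=-\widetilde{B_+(f)}(y)=u(x+2y)y$; - $\widetilde{gh}(v)=\tilde g(\tilde h(v))$ for all forests $g,h$ and $v\in\{x,y\}$; - $\tilde f(wv)=\sum_{(f)}\tilde f_1(w)\,\tilde f_2(v)$ for every forest $f$, $w\in\mathfrak{H}$ and $v\in\{x,y\}$, where $\Delta(f)=\sum_{(f)}f_1\otimes f_2$. Let $\rho:\mathcal{H}\to\mathrm{End}(\mathfrak{H})$ be $\rho(f)=\tilde f$, and let $\widetilde{\mathcal{H}}=\operatorname{Im}\rho$ be the space of rooted tree maps. Let $\mathcal{U}_0=\{\mathbb{I}\}$ and, for $d\ge 1$, $$\mathcal{U}_d=\{B_+(f)\mid f\in\mathcal{U}_{d-1}\}\cup\{\bullet f\mid f\in\mathcal{U}_{d-1}\}.$$ **Theorem.** The sets $\mathcal{U}_d$ $(d\ge 0)$ are pairwise disjoint, and $\rho\left(\bigsqcup_{d\ge 0}\mathcal{U}_d\right)$ forms a basis of the $\mathbb{Q}$-vector space $\widetilde{\mathcal{H}}$; that is, the family $(\rho(u))_{u\in\bigsqcup_{d}\mathcal{U}_d}$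 is linearly independent and spans $\widetilde{\mathcal{H}}$. -/

import Mathlib

namespace RootedTreeMaps

open scoped TensorProduct

/-- A planar rooted tree: a root together with the ordered list of the subtrees attached to it. -/
inductive PlanarTree : Type
  | node (branches : List PlanarTree) : PlanarTree

/-- Elementary isomorphisms of planar trees: reorder the branches at the root, or replace one
branch by an isomorphic one. The equivalence relation generated by it is isomorphism of rooted
trees. -/
inductive PlanarTree.Iso : PlanarTree → PlanarTree → Prop
  | perm {l l' : List PlanarTree} (h : l.Perm l') : PlanarTree.Iso (.node l) (.node l')
  | branch (l₁ l₂ : List PlanarTree) {s s' : PlanarTree} (h : PlanarTree.Iso s s') :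
      PlanarTree.Iso (.node (l₁ ++ s :: l₂)) (.node (l₁ ++ s' :: l₂))

/-- The set of isomorphism classes of (non-planar) rooted trees. -/
def RootedTree : Type := Quot PlanarTree.Iso

/-- The set of isomorphism classes of rooted forests: a forest is a finite multiset of rooted trees,
the product of forests is their disjoint union (the sum of multisets), and the empty forest is
`0`. -/
abbrev Forest : Type := Multiset RootedTree

/-- The number of vertices of a planar tree. -/
def PlanarTree.size : PlanarTree → ℕ
  | .node l => 1 + (l.map fun s => s.size).sum

theorem PlanarTree.Iso.size_eq {s t : PlanarTree} (h : PlanarTree.Iso s t) : s.size = t.size := by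
  induction h with
  | perm h => simp only [PlanarTree.size]; rw [(h.map _).sum_eq]
  | branch l₁ l₂ _ ih => simp [PlanarTree.size, ih]

namespace RootedTree

/-- The isomorphism class of a planar tree. -/
def mk (t : PlanarTree) : RootedTree := Quot.mk PlanarTree.Iso t

/-- A planar tree representing a rooted tree. -/
noncomputable def out (t : RootedTree) : PlanarTree := Quot.out t

theorem mk_out (t : RootedTree) : mk t.out = t := Quot.out_eq t

theorem map_mk_out (l : List RootedTree) : (l.map out).map mk = l := by
  rw [List.map_map, show mk ∘ out = id from funext mk_out, List.map_id]

theorem mk_surj (t : RootedTree) : ∃ l, mk (.node l) = t := by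
  obtain ⟨⟨l⟩, h⟩ := Quot.exists_rep t
  exact ⟨l, h⟩

theorem mk_sound {s t : PlanarTree} (h : PlanarTree.Iso s t) : mk s = mk t := Quot.sound h

/-- The degree of a rooted tree: its number of vertices. -/
def degree : RootedTree → ℕ := Quot.lift PlanarTree.size fun _ _ h => h.size_eq

/-- The forest obtained from a rooted tree by removing the root. -/
def branches : RootedTree → Forest :=
  Quot.lift (fun | .node l => ((l.map mk : List RootedTree) : Forest)) (by
    intro s t h
    cases h with
    | perm h => exact Quot.sound (h.map _)
    | branch l₁ l₂ h => simp [mk_sound h])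

/-- The rooted tree obtained by connecting the roots of all the trees of a forest to a new root. -/
noncomputable def graft (f : Forest) : RootedTree := mk (.node (f.toList.map out))

theorem branches_mk (l : List PlanarTree) :
    (mk (.node l)).branches = ((l.map mk : List RootedTree) : Forest) := rfl

theorem branches_graft (f : Forest) : (graft f).branches = f := by
  rw [graft, branches_mk, map_mk_out, Multiset.coe_toList]

theorem mk_node_congr (l₁ l l' : List PlanarTree) (h : l.map mk = l'.map mk) :
    mk (.node (l₁ ++ l)) = mk (.node (l₁ ++ l')) := by
  induction l generalizing l₁ l' with
  | nil =>
    cases l' with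
    | nil => rfl
    | cons _ _ => simp at h
  | cons a l ih =>
    cases l' with
    | nil => simp at h
    | cons b l' =>
      simp only [List.map_cons, List.cons.injEq] at h
      have h1 : ∀ s s' : PlanarTree, Relation.EqvGen PlanarTree.Iso s s' →
          mk (.node (l₁ ++ s :: l)) = mk (.node (l₁ ++ s' :: l)) := by
        intro s s' hs
        induction hs with
        | rel _ _ h => exact mk_sound (.branch _ _ h)
        | refl => rfl
        | symm _ _ _ ih => exact ih.symm
        | trans _ _ _ _ _ ih₁ ih₂ => exact ih₁.trans ih₂
      rw [h1 a b (Quot.eqvGen_exact h.1)]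
      have := ih (l₁ ++ [b]) l' h.2
      simpa using this

theorem graft_branches (t : RootedTree) : graft t.branches = t := by
  obtain ⟨l, rfl⟩ := mk_surj t
  rw [branches_mk, graft]
  have hp : (Multiset.toList ((l.map mk : List RootedTree) : Forest)).Perm (l.map mk) := by
    rw [← Multiset.coe_eq_coe]; simp
  rw [mk_sound (PlanarTree.Iso.perm (hp.map out))]
  exact mk_node_congr [] _ _ (map_mk_out _)

theorem degree_eq (t : RootedTree) : t.degree = 1 + (t.branches.map degree).sum := by
  obtain ⟨l, rfl⟩ := mk_surj t
  rw [branches_mk, Multiset.map_coe, Multiset.sum_coe, List.map_map,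
    show degree ∘ mk = PlanarTree.size from rfl]
  change PlanarTree.size (.node l) = _
  rw [PlanarTree.size]

theorem degree_lt {s t : RootedTree} (h : s ∈ t.branches) : s.degree < t.degree := by
  rw [degree_eq t]
  have := Multiset.single_le_sum (fun _ _ => Nat.zero_le _) _ (Multiset.mem_map_of_mem degree h)
  omega

/-- Every tree is the grafting of a forest of smaller trees. -/
theorem induction_on {P : RootedTree → Prop} (t : RootedTree)
    (h : ∀ f : Forest, (∀ s ∈ f, P s) → P (graft f)) : P t := by
  induction hn : t.degree using Nat.strong_induction_on generalizing t with
  | _ n ih =>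
    rw [← graft_branches t]
    exact h _ fun s hs => ih _ (hn ▸ degree_lt hs) s rfl

end RootedTree

/-- The algebra of rooted forests: the free commutative `ℚ`-algebra generated by the rooted
trees. -/
abbrev ForestAlgebra : Type := MvPolynomial RootedTree ℚ

/-- A forest as an element of the algebra: the product of its trees. -/
noncomputable def Forest.toAlgebra (f : Forest) : ForestAlgebra := (f.map MvPolynomial.X).prod

/-- The tree with a single vertex. -/
noncomputable def dot : ForestAlgebra := MvPolynomial.X (RootedTree.graft 0)

/-- The grafting operator `B₊`, the linear map that sends a forest `f` (a monomial in the trees) to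
the tree obtained by grafting all the trees of `f` on a new root. -/
noncomputable def bPlus : ForestAlgebra →ₗ[ℚ] ForestAlgebra :=
  (MvPolynomial.basisMonomials RootedTree ℚ).constr ℚ fun m =>
    MvPolynomial.X (RootedTree.graft (Finsupp.toMultiset m))

theorem basisMonomials_eq (m : RootedTree →₀ ℕ) :
    MvPolynomial.basisMonomials RootedTree ℚ m = Forest.toAlgebra (Finsupp.toMultiset m) := by
  classical
  rw [MvPolynomial.coe_basisMonomials]
  change MvPolynomial.monomial m (1 : ℚ) = _
  rw [MvPolynomial.monomial_eq, Forest.toAlgebra, map_one, one_mul]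
  induction m using Finsupp.induction with
  | zero => simp
  | single_add a b f ha hb ih =>
    rw [Finsupp.prod_add_index' (by simp) (by intros; rw [pow_add]), ih]
    simp [Multiset.map_nsmul, Multiset.prod_nsmul]

theorem bPlus_toAlgebra (f : Forest) :
    bPlus f.toAlgebra = MvPolynomial.X (RootedTree.graft f) := by
  classical
  have h := basisMonomials_eq (Multiset.toFinsupp f)
  rw [Multiset.toFinsupp_toMultiset] at h
  rw [← h, bPlus, Module.Basis.constr_basis, Multiset.toFinsupp_toMultiset]

/-- The coproduct of a tree: `Δ(t) = t ⊗ 𝕀 + (id ⊗ B₊)(Δ(f))` for `t = B₊(f)`, where `Δ(f)` is the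
product of the coproducts of the trees of `f`. -/
noncomputable def coproductTree (t : RootedTree) : ForestAlgebra ⊗[ℚ] ForestAlgebra :=
  MvPolynomial.X t ⊗ₜ[ℚ] 1 +
    bPlus.lTensor ForestAlgebra ((t.branches.attach.map fun s => coproductTree s.1).prod)
termination_by t.degree
decreasing_by exact RootedTree.degree_lt s.2

/-- The coproduct `Δ` of the Hopf algebra of rooted trees, extended multiplicatively. -/
noncomputable def coproduct : ForestAlgebra →ₐ[ℚ] ForestAlgebra ⊗[ℚ] ForestAlgebra :=
  MvPolynomial.aeval coproductTree

theorem coproduct_toAlgebra (f : Forest) :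
    coproduct f.toAlgebra = (f.map coproductTree).prod := by
  rw [coproduct, Forest.toAlgebra, map_multiset_prod, Multiset.map_map]
  simp

theorem coproduct_graft (f : Forest) :
    coproduct (MvPolynomial.X (RootedTree.graft f)) =
      MvPolynomial.X (RootedTree.graft f) ⊗ₜ[ℚ] 1 +
        bPlus.lTensor ForestAlgebra (coproduct f.toAlgebra) := by
  rw [coproduct_toAlgebra, coproduct, MvPolynomial.aeval_X, coproductTree,
    RootedTree.branches_graft, Multiset.attach_map_val' f coproductTree]

theorem toAlgebra_zero : Forest.toAlgebra 0 = 1 := by simp [Forest.toAlgebra]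

theorem toAlgebra_cons (t : RootedTree) (f : Forest) :
    Forest.toAlgebra (t ::ₘ f) = MvPolynomial.X t * f.toAlgebra := by simp [Forest.toAlgebra]

theorem toAlgebra_add (f g : Forest) :
    Forest.toAlgebra (f + g) = f.toAlgebra * g.toAlgebra := by simp [Forest.toAlgebra]

/-- A linear statement about the forest algebra can be checked on forests. -/
theorem forest_induction {P : ForestAlgebra → Prop} (h : ∀ f : Forest, P f.toAlgebra)
    (add : ∀ a b, P a → P b → P (a + b)) (smul : ∀ (c : ℚ) a, P a → P (c • a)) (a) : P a := by
  have : a ∈ Submodule.span ℚ (Set.range (MvPolynomial.basisMonomials RootedTree ℚ)) := by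
    rw [Module.Basis.span_eq]; trivial
  induction this using Submodule.span_induction with
  | mem x hx => obtain ⟨m, rfl⟩ := hx; rw [basisMonomials_eq]; exact h _
  | zero => simpa using smul 0 _ (h 0)
  | add x y _ _ hx hy => exact add _ _ hx hy
  | smul c x _ hx => exact smul c _ hx

/-- The two letters of the words. -/
inductive Letter : Type
  | x
  | y

/-- The noncommutative polynomial ring `ℚ⟨x, y⟩`. -/
abbrev Words : Type := FreeAlgebra ℚ Letter

namespace Words

/-- The letter `x` as a polynomial. -/
def x : Words := FreeAlgebra.ι ℚ Letter.x

/-- The letter `y` as a polynomial. -/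
def y : Words := FreeAlgebra.ι ℚ Letter.y

end Words

open Words in
/-- The conditions that define the rooted tree maps `f ↦ f̃ = ρ f`, extended linearly from forests
to the whole algebra:
* `𝕀̃ = id`, and `•̃(x) = -•̃(y) = xy`;
* for a forest `f ≠ 𝕀`, `f̃(x)` ends with `y`, say `f̃(x) = uy`, and then
  `B₊(f)̃(x) = -B₊(f)̃(y) = u(x + 2y)y`;
* `(gh)̃(v) = g̃(h̃(v))` for forests `g`, `h` and a letter `v`;
* `f̃(wv) = M(Δ(f)̃(w ⊗ v))` for a forest `f`, a polynomial `w` and a letter `v`, where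
  `Δ(f)̃ = ∑ f̃₁ ⊗ f̃₂` if `Δ(f) = ∑ f₁ ⊗ f₂`, and `M` is the concatenation product. -/
structure IsRootedTreeMap (ρ : ForestAlgebra →ₗ[ℚ] Module.End ℚ Words) : Prop where
  one : ρ 1 = LinearMap.id
  dot_x : ρ dot x = x * y
  dot_y : ρ dot y = -(x * y)
  graft : ∀ f : Forest, f ≠ 0 → ∃ u : Words, ρ f.toAlgebra x = u * y ∧
    ρ (bPlus f.toAlgebra) x = u * (x + 2 * y) * y ∧
    ρ (bPlus f.toAlgebra) y = -(u * (x + 2 * y) * y)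
  mul : ∀ g h : Forest, ∀ v ∈ ({x, y} : Set Words),
    ρ (g.toAlgebra * h.toAlgebra) v = ρ g.toAlgebra (ρ h.toAlgebra v)
  coproduct : ∀ (f : Forest) (w : Words), ∀ v ∈ ({x, y} : Set Words),
    ρ f.toAlgebra (w * v) = LinearMap.mul' ℚ Words
      (TensorProduct.homTensorHomMap (RingHom.id ℚ) Words Words Words Words
        (TensorProduct.map ρ ρ (coproduct f.toAlgebra)) (w ⊗ₜ[ℚ] v))

namespace Words

/-! ### Words in the letters `z = x + y` and `y` -/

/-- The sum of the two letters. -/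
def z : Words := x + y

theorem x_eq : x = z - y := by simp [z]

theorem right_induction {P : Words → Prop} (one : P 1) (hz : ∀ a, P a → P (a * z))
    (hy : ∀ a, P a → P (a * y)) (add : ∀ a b, P a → P b → P (a + b))
    (smul : ∀ (c : ℚ) a, P a → P (c • a)) (a : Words) : P a := by
  suffices h : ∀ b, P b → P (b * a) by simpa using h 1 one
  induction a using FreeAlgebra.induction with
  | grade0 r => intro b hb; rw [← Algebra.commutes, ← Algebra.smul_def]; exact smul _ _ hb
  | grade1 l =>
    intro b hb
    cases l with
    | x =>
      have : b * FreeAlgebra.ι ℚ Letter.x = b * z + (-1 : ℚ) • (b * y) := by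
        simp [z, x, mul_add]
      rw [this]
      exact add _ _ (hz _ hb) (smul _ _ (hy _ hb))
    | y => exact hy _ hb
  | mul a b ha hb => intro c hc; rw [← mul_assoc]; exact hb _ (ha _ hc)
  | add a b ha hb => intro c hc; rw [mul_add]; exact add _ _ (ha _ hc) (hb _ hc)

theorem left_induction {P : Words → Prop} (one : P 1) (hz : ∀ a, P a → P (z * a))
    (hx : ∀ a, P a → P (x * a)) (add : ∀ a b, P a → P b → P (a + b))
    (smul : ∀ (c : ℚ) a, P a → P (c • a)) (a : Words) : P a := by
  suffices h : ∀ b, P b → P (a * b) by simpa using h 1 one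
  induction a using FreeAlgebra.induction with
  | grade0 r => intro b hb; rw [← Algebra.smul_def]; exact smul _ _ hb
  | grade1 l =>
    intro b hb
    cases l with
    | x => exact hx _ hb
    | y =>
      have : FreeAlgebra.ι ℚ Letter.y * b = z * b + (-1 : ℚ) • (x * b) := by
        simp [z, y, add_mul]
      rw [this]
      exact add _ _ (hz _ hb) (smul _ _ (hx _ hb))
  | mul a b ha hb => intro c hc; rw [mul_assoc]; exact ha _ (hb _ hc)
  | add a b ha hb => intro c hc; rw [add_mul]; exact add _ _ (ha _ hc) (hb _ hc)

/-- The automorphism `x ↦ x + y`, `y ↦ y`. -/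
noncomputable def changeLetters : Words ≃ₐ[ℚ] Words :=
  AlgEquiv.ofAlgHom
    (FreeAlgebra.lift ℚ fun | .x => x + y | .y => y)
    (FreeAlgebra.lift ℚ fun | .x => x - y | .y => y)
    (by ext l; cases l <;> simp [x, y]) (by ext l; cases l <;> simp [x, y])

/-- The basis of words in `z` and `y`; lists are read from right to left. -/
noncomputable def basis : Module.Basis (List Letter) ℚ Words :=
  ((FreeAlgebra.basisFreeMonoid ℚ Letter).map changeLetters.toLinearEquiv).reindex
    (FreeMonoid.toList.trans (Function.Involutive.toPerm _ List.reverse_involutive))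

theorem basisFreeMonoid_apply (l : FreeMonoid Letter) :
    FreeAlgebra.basisFreeMonoid ℚ Letter l = FreeMonoid.lift (FreeAlgebra.ι ℚ) l := by
  simp [FreeAlgebra.basisFreeMonoid, FreeAlgebra.equivMonoidAlgebraFreeMonoid]

theorem basis_apply (l : List Letter) : basis l =
    changeLetters (FreeMonoid.lift (FreeAlgebra.ι ℚ) (FreeMonoid.ofList l.reverse)) := by
  simp [basis, basisFreeMonoid_apply]

theorem basis_nil : basis [] = 1 := by simp [basis_apply]

theorem basis_x (l : List Letter) : basis (.x :: l) = basis l * z := by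
  simp [basis_apply, FreeMonoid.ofList_append, FreeMonoid.lift_apply, changeLetters, z]

theorem basis_y (l : List Letter) : basis (.y :: l) = basis l * y := by
  simp [basis_apply, FreeMonoid.ofList_append, FreeMonoid.lift_apply, changeLetters]

theorem word_induction {P : Words → Prop} (h : ∀ l, P (basis l))
    (add : ∀ a b, P a → P b → P (a + b)) (smul : ∀ (c : ℚ) a, P a → P (c • a)) (a) : P a := by
  have : a ∈ Submodule.span ℚ (Set.range basis) := by
    rw [Module.Basis.span_eq]; trivial
  induction this using Submodule.span_induction with
  | mem x hx => obtain ⟨l, rfl⟩ := hx; exact h _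
  | zero => simpa using smul 0 _ (h [])
  | add x y _ _ hx hy => exact add _ _ hx hy
  | smul c x _ hx => exact smul c _ hx

/-! ### The product `⋄` -/

/-- The product `⋄` of two words in `z` and `y`. -/
noncomputable def diaWord : List Letter → List Letter → Words
  | [], w => basis w
  | .x :: v, w => diaWord v w * z
  | .y :: v, [] => basis (.y :: v)
  | .y :: v, .x :: w => diaWord (.y :: v) w * z
  | .y :: v, .y :: w => diaWord v (.y :: w) * y + diaWord (.y :: v) w * y - diaWord v w * z * y

/-- The bilinear product `⋄` on the noncommutative polynomial ring. -/
noncomputable def dia : Words →ₗ[ℚ] Words →ₗ[ℚ] Words :=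
  basis.constr ℚ fun v => basis.constr ℚ fun w => diaWord v w

theorem dia_basis (v w : List Letter) : dia (basis v) (basis w) = diaWord v w := by
  simp [dia, Module.Basis.constr_basis]

theorem one_dia (w : Words) : dia 1 w = w := by
  induction w using word_induction with
  | h l => rw [← basis_nil, dia_basis, diaWord]
  | add a b ha hb => simp [ha, hb]
  | smul c a ha => simp [ha]

theorem dia_one (w : Words) : dia w 1 = w := by
  induction w using word_induction with
  | h l =>
    rw [← basis_nil, dia_basis]
    induction l with
    | nil => simp [diaWord]
    | cons a l ih => cases a <;> simp [diaWord, basis_x, ih]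
  | add a b ha hb => simp [ha, hb]
  | smul c a ha => simp [ha]

theorem mul_z_dia (v w : Words) : dia (v * z) w = dia v w * z := by
  induction v using word_induction with
  | h l =>
    induction w using word_induction with
    | h m => rw [← basis_x, dia_basis, dia_basis, diaWord]
    | add a b ha hb => simp [ha, hb, add_mul]
    | smul c a ha => simp [ha]
  | add a b ha hb => simp [ha, hb, add_mul]
  | smul c a ha => simp [ha]

theorem diaWord_x (v w : List Letter) : diaWord v (.x :: w) = diaWord v w * z := by
  induction v with
  | nil => simp [diaWord, basis_x]
  | cons a l ih => cases a <;> simp [diaWord, ih]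

theorem dia_mul_z (v w : Words) : dia v (w * z) = dia v w * z := by
  induction v using word_induction with
  | h l =>
    induction w using word_induction with
    | h m => rw [← basis_x, dia_basis, dia_basis, diaWord_x]
    | add a b ha hb => simp [ha, hb, add_mul]
    | smul c a ha => simp [ha]
  | add a b ha hb => simp [ha, hb, add_mul]
  | smul c a ha => simp [ha]

theorem mul_y_dia_mul_y (v w : Words) :
    dia (v * y) (w * y) = dia v (w * y) * y + dia (v * y) w * y - dia v w * z * y := by
  induction v using word_induction with
  | h l =>
    induction w using word_induction with
    | h m => simp only [← basis_y, dia_basis]; rw [diaWord]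
    | add a b ha hb => simp only [map_add, add_mul, ha, hb]; abel
    | smul c a ha => simp only [map_smul, smul_mul_assoc, ha, smul_add, smul_sub]
  | add a b ha hb => simp only [map_add, LinearMap.add_apply, add_mul, ha, hb]; abel
  | smul c a ha =>
    simp only [map_smul, LinearMap.smul_apply, smul_mul_assoc, ha, smul_add, smul_sub]

theorem dia_comm (v w : Words) : dia v w = dia w v := by
  induction v using word_induction with
  | h l =>
    induction w using word_induction with
    | h m =>
      induction l generalizing m with
      | nil => rw [basis_nil, one_dia, dia_one]
      | cons a l ihl =>
        cases a with
        | x => rw [basis_x, mul_z_dia, dia_mul_z, ihl]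
        | y =>
          induction m with
          | nil => rw [basis_nil, one_dia, dia_one]
          | cons b m ihm =>
            cases b with
            | x => rw [basis_x, mul_z_dia, dia_mul_z, ihm]
            | y =>
              have h1 := ihl (.y :: m)
              have h2 := ihl m
              simp only [basis_y] at ihm h1 h2 ⊢
              rw [mul_y_dia_mul_y, mul_y_dia_mul_y, ihm, h1, h2]
              abel
    | add a b ha hb => simp [ha, hb]
    | smul c a ha => simp [ha]
  | add a b ha hb => simp [ha, hb]
  | smul c a ha => simp [ha]

theorem dia_assoc (u v w : Words) : dia (dia u v) w = dia u (dia v w) := by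
  induction u using word_induction with
  | h l =>
    induction v using word_induction with
    | h m =>
      induction w using word_induction with
      | h n =>
        induction l generalizing m n with
        | nil => rw [basis_nil, one_dia, one_dia]
        | cons a l ihl =>
          cases a with
          | x => rw [basis_x, mul_z_dia, mul_z_dia, mul_z_dia, ihl]
          | y =>
            induction m generalizing n with
            | nil => rw [basis_nil, one_dia, dia_one]
            | cons b m ihm =>
              cases b with
              | x => rw [basis_x, dia_mul_z, mul_z_dia, mul_z_dia, dia_mul_z, ihm]
              | y =>
                induction n with
                | nil => rw [basis_nil, dia_one, dia_one]
                | cons c n ihn =>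
                  cases c with
                  | x => rw [basis_x, dia_mul_z, dia_mul_z, dia_mul_z, ihn]
                  | y =>
                    have a1 := ihl (.y :: m) (.y :: n)
                    have a2 := ihl m (.y :: n)
                    have a3 := ihl (.y :: m) n
                    have a4 := ihl m n
                    have b1 := ihm (.y :: n)
                    have b2 := ihm n
                    simp only [basis_y] at a1 a2 a3 a4 b1 b2 ihn ⊢
                    generalize basis l = U at *
                    generalize basis m = V at *
                    generalize basis n = W at *
                    have hA := mul_y_dia_mul_y U V
                    have hB := mul_y_dia_mul_y V W
                    rw [← add_mul, ← sub_mul] at hA hB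
                    set A := dia U (V * y) + dia (U * y) V - dia U V * z with hAdef
                    set B := dia V (W * y) + dia (V * y) W - dia V W * z with hBdef
                    rw [hA, mul_y_dia_mul_y A W, hB, mul_y_dia_mul_y U B, ← hB, ← hA, ihn]
                    have hA1 : dia A (W * y) = dia U (dia (V * y) (W * y)) +
                        dia (U * y) (dia V (W * y)) - dia U (dia V (W * y)) * z := by
                      simp only [hAdef, map_sub, map_add, LinearMap.sub_apply,
                        LinearMap.add_apply, mul_z_dia, a1, a2, b1]
                    have hA2 : dia A W = dia U (dia (V * y) W) + dia (U * y) (dia V W) -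
                        dia U (dia V W) * z := by
                      simp only [hAdef, map_sub, map_add, LinearMap.sub_apply,
                        LinearMap.add_apply, mul_z_dia, a3, a4, b2]
                    have hB1 : dia (U * y) B = dia (U * y) (dia V (W * y)) +
                        dia (U * y) (dia (V * y) W) - dia (U * y) (dia V W) * z := by
                      simp only [hBdef, map_sub, map_add, dia_mul_z]
                    have hB2 : dia U B = dia U (dia V (W * y)) + dia U (dia (V * y) W) -
                        dia U (dia V W) * z := by
                      simp only [hBdef, map_sub, map_add, dia_mul_z]
                    rw [hA1, hA2, hB1, hB2]
                    noncomm_ring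
      | add a b ha hb => simp [ha, hb]
      | smul c a ha => simp [ha]
    | add a b ha hb => simp [ha, hb]
    | smul c a ha => simp [ha]
  | add a b ha hb => simp [ha, hb]
  | smul c a ha => simp [ha]

theorem dia_mul_x (u v : Words) : dia u (v * x) = dia u v * z - dia u (v * y) := by
  rw [x_eq, mul_sub, map_sub, dia_mul_z]

/-- The constant term. -/
noncomputable def const : Words →ₐ[ℚ] ℚ := FreeAlgebra.lift ℚ fun _ => 0

theorem const_x : const x = 0 := by simp [const, x]
theorem const_y : const y = 0 := by simp [const, y]
theorem const_z : const z = 0 := by simp [z, const_x, const_y]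

theorem const_dia (u v : Words) : const (dia u v) = const u * const v := by
  induction u using right_induction with
  | one => simp [one_dia]
  | hz a ha => simp [mul_z_dia, const_z]
  | hy a ha =>
    clear ha
    induction v using right_induction with
    | one => simp [dia_one]
    | hz a ha => simp [dia_mul_z, const_z]
    | hy a ha => simp [mul_y_dia_mul_y, const_y]
    | add a b ha hb => simp [ha, hb, mul_add]
    | smul c a ha => simp [ha, mul_left_comm]
  | add a b ha hb => simp [ha, hb, add_mul]
  | smul c a ha => simp [ha, mul_assoc]

theorem exists_of_const (a : Words) : ∃ p q, a = algebraMap ℚ Words (const a) + p * z + q * y := by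
  induction a using right_induction with
  | one => exact ⟨0, 0, by simp⟩
  | hz a _ => exact ⟨a, 0, by simp [const_z]⟩
  | hy a _ => exact ⟨0, a, by simp [const_y]⟩
  | add a b ha hb =>
    obtain ⟨p, q, h⟩ := ha
    obtain ⟨p', q', h'⟩ := hb
    refine ⟨p + p', q + q', ?_⟩
    conv_lhs => rw [h, h']
    simp only [map_add]; noncomm_ring
  | smul c a ha =>
    obtain ⟨p, q, h⟩ := ha
    refine ⟨c • p, c • q, ?_⟩
    conv_lhs => rw [h]
    simp [Algebra.smul_def, mul_add, mul_assoc]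

/-- The linear map with `1 ↦ y` and `uy ↦ u(x + 2y)y`, extended to all polynomials by
`ux ↦ uxy`. -/
noncomputable def root : Words →ₗ[ℚ] Words :=
  basis.constr ℚ fun
    | [] => y
    | .x :: l => (2 : ℚ) • (basis l * z * y)
    | .y :: l => basis l * (z + y) * y

theorem root_one : root 1 = y := by
  rw [← basis_nil, root, Module.Basis.constr_basis]

theorem root_mul_z (a : Words) : root (a * z) = (2 : ℚ) • (a * z * y) := by
  induction a using word_induction with
  | h l => rw [← basis_x, root, Module.Basis.constr_basis, basis_x]
  | add a b ha hb => simp [ha, hb, add_mul]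
  | smul c a ha => simp [ha, smul_comm c]

theorem root_mul_y (a : Words) : root (a * y) = a * (z + y) * y := by
  induction a using word_induction with
  | h l => rw [← basis_y, root, Module.Basis.constr_basis]
  | add a b ha hb => simp only [add_mul, map_add, ha, hb]
  | smul c a ha => simp [ha]

theorem root_mul (p q : Words) (hq : const q = 0) : root (p * q) = p * root q := by
  obtain ⟨a, b, h⟩ := exists_of_const q
  rw [hq, map_zero, zero_add] at h
  rw [h, mul_add, map_add, ← mul_assoc, ← mul_assoc, root_mul_z, root_mul_y, map_add, root_mul_z,
    root_mul_y]
  simp only [mul_assoc, mul_add, add_mul, mul_smul_comm]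

theorem root_x_mul (q : Words) : root (x * q) = x * root q := by
  induction q using right_induction with
  | one =>
    have h : x = 1 * z - 1 * y := by simp [z]
    rw [mul_one, root_one, h, map_sub, root_mul_z, root_mul_y, two_smul]
    noncomm_ring
  | hz a _ => exact root_mul _ _ (by simp [const_z])
  | hy a _ => exact root_mul _ _ (by simp [const_y])
  | add a b ha hb => simp [mul_add, ha, hb]
  | smul c a ha => simp [ha]

theorem const_root (a : Words) : const (root a) = 0 := by
  induction a using right_induction with
  | one => simp [root_one, const_y]
  | hz a _ => simp [root_mul_z, const_y]
  | hy a _ => simp [root_mul_y, const_y]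
  | add a b ha hb => simp [ha, hb]
  | smul c a ha => simp [ha]

theorem exists_root (a : Words) : ∃ u, root a = u * y := by
  induction a using right_induction with
  | one => exact ⟨1, by simp [root_one]⟩
  | hz a _ => exact ⟨(2 : ℚ) • (a * z), by simp [root_mul_z]⟩
  | hy a _ => exact ⟨_, root_mul_y a⟩
  | add a b ha hb =>
    obtain ⟨u, hu⟩ := ha
    obtain ⟨v, hv⟩ := hb
    exact ⟨u + v, by rw [map_add, hu, hv, add_mul]⟩
  | smul c a ha =>
    obtain ⟨u, hu⟩ := ha
    exact ⟨c • u, by simp [hu]⟩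

theorem root_dia_mul_y (a w : Words) :
    dia (root a) (w * y) = dia (root a) w * y - root (dia a (w * x)) := by
  have hx : ∀ b : Words, root (b * x) = b * x * y := by
    intro b
    rw [x_eq, mul_sub, map_sub, root_mul_z, root_mul_y, two_smul]
    noncomm_ring
  induction a using right_induction with
  | one =>
    rw [root_one, one_dia, hx]
    have h := mul_y_dia_mul_y 1 w
    rw [one_mul, one_dia, one_dia] at h
    rw [h, x_eq]; noncomm_ring
  | hz u _ =>
    have h := mul_y_dia_mul_y (u * z) w
    rw [mul_z_dia, mul_z_dia] at h
    rw [root_mul_z, mul_z_dia, dia_mul_x, root_mul_z, map_smul, LinearMap.smul_apply,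
      LinearMap.smul_apply, h, smul_mul_assoc, ← smul_sub]
    congr 1
    noncomm_ring
  | hy u _ =>
    have h1 : root (u * y) = (u * z + u * y) * y := by rw [root_mul_y, mul_add]
    have h2 := mul_y_dia_mul_y (u * z + u * y) w
    have h3 : dia (u * y) (w * x) = dia (u * y) w * z
        - (dia u (w * y) + dia (u * y) w - dia u w * z) * y := by
      rw [dia_mul_x, mul_y_dia_mul_y]; noncomm_ring
    have h4 : dia (u * z + u * y) (w * y) = dia u (w * y) * z +
        (dia u (w * y) * y + dia (u * y) w * y - dia u w * z * y) := by
      rw [map_add, LinearMap.add_apply, mul_z_dia, mul_y_dia_mul_y]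
    have h5 : dia (u * z + u * y) w = dia u w * z + dia (u * y) w := by
      rw [map_add, LinearMap.add_apply, mul_z_dia]
    rw [h1, h2, h4, h5, h3, map_sub, root_mul_z, root_mul_y, two_smul]
    noncomm_ring
  | add a b ha hb => simp only [map_add, LinearMap.add_apply, ha, hb, add_mul]; abel
  | smul c a ha => simp only [map_smul, LinearMap.smul_apply, ha, smul_mul_assoc, smul_sub]

/-- The polynomials with the commutative product `⋄`. -/
def Diamond : Type := Words

noncomputable instance : AddCommGroup Diamond := inferInstanceAs (AddCommGroup Words)
noncomputable instance : Module ℚ Diamond := inferInstanceAs (Module ℚ Words)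

/-- The identity map to the polynomials with the product `⋄`. -/
def toDiamond : Words ≃ₗ[ℚ] Diamond := LinearEquiv.refl ℚ Words

noncomputable instance : CommRing Diamond where
  mul a b := toDiamond (dia (toDiamond.symm a) (toDiamond.symm b))
  one := toDiamond 1
  mul_assoc a b c := congrArg toDiamond (dia_assoc _ _ _)
  mul_comm a b := congrArg toDiamond (dia_comm _ _)
  one_mul a := congrArg toDiamond (one_dia _)
  mul_one a := congrArg toDiamond (dia_one _)
  zero_mul a := congrArg toDiamond (LinearMap.map_zero₂ dia (toDiamond.symm a))
  mul_zero a := congrArg toDiamond (map_zero (dia (toDiamond.symm a)))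
  left_distrib a b c := congrArg toDiamond
    (map_add (dia (toDiamond.symm a)) (toDiamond.symm b) (toDiamond.symm c))
  right_distrib a b c := congrArg toDiamond
    (LinearMap.map_add₂ dia (toDiamond.symm a) (toDiamond.symm b) (toDiamond.symm c))
  zsmul n a := n • a
  zsmul_zero' := SubNegMonoid.zsmul_zero'
  zsmul_succ' := SubNegMonoid.zsmul_succ'
  zsmul_neg' := SubNegMonoid.zsmul_neg'
  neg_add_cancel := neg_add_cancel

theorem mul_def (a b : Diamond) :
    toDiamond.symm (a * b) = dia (toDiamond.symm a) (toDiamond.symm b) := rfl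

theorem one_def : toDiamond.symm 1 = 1 := rfl

noncomputable instance : Algebra ℚ Diamond :=
  Algebra.ofModule
    (fun r a b => congrArg toDiamond
      (LinearMap.map_smul₂ dia r (toDiamond.symm a) (toDiamond.symm b)))
    (fun r a b => congrArg toDiamond
      (map_smul (dia (toDiamond.symm a)) r (toDiamond.symm b)))

/-- For a polynomial `u`, the linear map `w ↦ Φ u w` with `1 ↦ const u`, `x w ↦ x (u ⋄ w)` and
`z w ↦ z Φ u w`, on words. -/
noncomputable def actWord : List Letter → Words →ₗ[ℚ] Words
  | [] => Algebra.linearMap ℚ Words ∘ₗ const.toLinearMap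
  | .x :: l => LinearMap.mulLeft ℚ x ∘ₗ
      dia.flip (FreeAlgebra.basisFreeMonoid ℚ Letter (FreeMonoid.ofList l))
  | .y :: l => LinearMap.mulLeft ℚ z ∘ₗ actWord l - LinearMap.mulLeft ℚ x ∘ₗ
      dia.flip (FreeAlgebra.basisFreeMonoid ℚ Letter (FreeMonoid.ofList l))

/-- The action of polynomials on polynomials through which the rooted tree maps factor. -/
noncomputable def act : Words →ₗ[ℚ] Module.End ℚ Words :=
  ((FreeAlgebra.basisFreeMonoid ℚ Letter).constr ℚ fun l => actWord l.toList).flip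

theorem act_basis (u : Words) (l : List Letter) :
    act u (FreeAlgebra.basisFreeMonoid ℚ Letter (FreeMonoid.ofList l)) = actWord l u := by
  rw [act, LinearMap.flip_apply, Module.Basis.constr_basis, FreeMonoid.toList_ofList]

theorem act_one (u : Words) : act u 1 = algebraMap ℚ Words (const u) := by
  have := act_basis u []
  rw [basisFreeMonoid_apply] at this
  simpa [actWord] using this

theorem freeMonoid_induction {P : Words → Prop}
    (h : ∀ l, P (FreeAlgebra.basisFreeMonoid ℚ Letter (FreeMonoid.ofList l)))
    (add : ∀ a b, P a → P b → P (a + b)) (smul : ∀ (c : ℚ) a, P a → P (c • a)) (a) : P a := by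
  have : a ∈ Submodule.span ℚ (Set.range (FreeAlgebra.basisFreeMonoid ℚ Letter)) := by
    rw [Module.Basis.span_eq]; trivial
  induction this using Submodule.span_induction with
  | mem x hx => obtain ⟨l, rfl⟩ := hx; exact h l.toList
  | zero => simpa using smul 0 _ (h [])
  | add x y _ _ hx hy => exact add _ _ hx hy
  | smul c x _ hx => exact smul c _ hx

theorem basisFreeMonoid_cons (a : Letter) (l : List Letter) :
    FreeAlgebra.basisFreeMonoid ℚ Letter (FreeMonoid.ofList (a :: l)) =
      FreeAlgebra.ι ℚ a * FreeAlgebra.basisFreeMonoid ℚ Letter (FreeMonoid.ofList l) := by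
  simp [basisFreeMonoid_apply, FreeMonoid.lift_apply]

theorem act_x_mul (u w : Words) : act u (x * w) = x * dia u w := by
  induction w using freeMonoid_induction with
  | h l =>
    have := act_basis u (.x :: l)
    rw [basisFreeMonoid_cons] at this
    exact this
  | add a b ha hb => simp [mul_add, ha, hb]
  | smul c a ha => simp [ha]

theorem act_z_mul (u w : Words) : act u (z * w) = z * act u w := by
  induction w using freeMonoid_induction with
  | h l =>
    have := act_basis u (.y :: l)
    rw [basisFreeMonoid_cons] at this
    rw [z, add_mul, map_add, act_x_mul]
    change _ + act u (FreeAlgebra.ι ℚ Letter.y * _) = _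
    rw [this, act_basis]
    simp [actWord, z]
  | add a b ha hb => simp [mul_add, ha, hb]
  | smul c a ha => simp [ha]

theorem act_x (u : Words) : act u x = x * u := by
  have := act_x_mul u 1
  rwa [mul_one, dia_one] at this

theorem act_y (u : Words) : act u y = algebraMap ℚ Words (const u) * z - x * u := by
  have h : y = z * 1 - x := by simp [z]
  rw [h, map_sub, act_z_mul, act_x, act_one, Algebra.commutes]

theorem act_mul_z (u w : Words) : act u (w * z) = act u w * z := by
  induction w using left_induction with
  | one =>
    have h : (1 : Words) * z = z * 1 := by simp
    rw [h, act_z_mul, act_one, Algebra.commutes]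
  | hz a ha => rw [mul_assoc, act_z_mul, ha, act_z_mul, mul_assoc]
  | hx a _ => rw [mul_assoc, act_x_mul, act_x_mul, dia_mul_z, mul_assoc]
  | add a b ha hb => simp [add_mul, ha, hb]
  | smul c a ha => simp [ha]

theorem one_act (w : Words) : act 1 w = w := by
  induction w using left_induction with
  | one => simp [act_one]
  | hz a ha => rw [act_z_mul, ha]
  | hx a _ => rw [act_x_mul, one_dia]
  | add a b ha hb => simp [ha, hb]
  | smul c a ha => simp [ha]

theorem dia_act (u v w : Words) : act (dia u v) w = act u (act v w) := by
  induction w using left_induction with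
  | one => simp [act_one, Algebra.algebraMap_eq_smul_one, const_dia, smul_smul, mul_comm]
  | hz a ha => simp only [act_z_mul, ha]
  | hx a _ => simp only [act_x_mul, dia_assoc]
  | add a b ha hb => simp [ha, hb]
  | smul c a ha => simp [ha]

theorem const_act (u w : Words) : const (act u w) = const u * const w := by
  induction w using left_induction with
  | one => simp [act_one]
  | hz a ha => simp [act_z_mul, const_z]
  | hx a _ => simp [act_x_mul, const_x]
  | add a b ha hb => simp [ha, hb, mul_add]
  | smul c a ha => simp [ha, mul_left_comm]

theorem act_root_mul_y (a w : Words) :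
    act (root a) (w * y) = act (root a) w * y - root (act a (w * x)) := by
  induction w using left_induction with
  | one => simp [act_y, act_x, act_one, const_root, root_x_mul]
  | hz w hw =>
    rw [mul_assoc, mul_assoc, act_z_mul, act_z_mul, act_z_mul, hw, root_mul, mul_sub, mul_assoc]
    simp [const_act, const_x]
  | hx w _ =>
    rw [mul_assoc, mul_assoc, act_x_mul, act_x_mul, act_x_mul, root_dia_mul_y, root_x_mul, mul_sub,
      mul_assoc]
  | add a b ha hb => simp only [add_mul, map_add, ha, hb]; abel
  | smul c a ha => simp only [smul_mul_assoc, map_smul, ha, smul_sub]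

end Words

/-! ### Existence of the rooted tree maps -/

open Words

/-- The polynomial attached to a rooted tree. -/
noncomputable def treePolynomial (t : RootedTree) : Diamond :=
  toDiamond (root (toDiamond.symm (t.branches.attach.map fun s => treePolynomial s.1).prod))
termination_by t.degree
decreasing_by exact RootedTree.degree_lt s.2

/-- The polynomial attached to an element of the forest algebra. -/
noncomputable def polynomial : ForestAlgebra →ₐ[ℚ] Diamond := MvPolynomial.aeval treePolynomial

theorem polynomial_toAlgebra (f : Forest) :
    polynomial f.toAlgebra = (f.map treePolynomial).prod := by
  rw [polynomial, Forest.toAlgebra, map_multiset_prod, Multiset.map_map]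
  simp

theorem polynomial_bPlus (a : ForestAlgebra) :
    polynomial (bPlus a) = toDiamond (root (toDiamond.symm (polynomial a))) := by
  induction a using forest_induction with
  | h f =>
    rw [polynomial_toAlgebra, bPlus_toAlgebra, polynomial, MvPolynomial.aeval_X, treePolynomial,
      RootedTree.branches_graft, Multiset.attach_map_val' f treePolynomial]
  | add a b ha hb => simp [ha, hb]
  | smul c a ha => simp [ha]

/-- The candidate for the rooted tree maps. -/
noncomputable def treeAction : ForestAlgebra →ₗ[ℚ] Module.End ℚ Words :=
  act ∘ₗ toDiamond.symm.toLinearMap ∘ₗ polynomial.toLinearMap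

theorem treeAction_apply (a : ForestAlgebra) :
    treeAction a = act (toDiamond.symm (polynomial a)) := rfl

theorem treeAction_one : treeAction 1 = LinearMap.id := by
  rw [treeAction_apply, map_one, one_def]; ext w; simp [one_act]

theorem treeAction_mul (a b : ForestAlgebra) (w : Words) :
    treeAction (a * b) w = treeAction a (treeAction b w) := by
  rw [treeAction_apply, map_mul, mul_def, dia_act]; rfl

theorem dot_eq : dot = bPlus 1 := by
  rw [dot, ← bPlus_toAlgebra, toAlgebra_zero]

theorem polynomial_dot : toDiamond.symm (polynomial dot) = y := by
  rw [dot_eq, polynomial_bPlus, map_one, LinearEquiv.symm_apply_apply, one_def, root_one]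

theorem polynomial_forest (f : Forest) (hf : f ≠ 0) :
    ∃ u, toDiamond.symm (polynomial f.toAlgebra) = u * y := by
  induction f using Multiset.induction with
  | empty => exact absurd rfl hf
  | cons t f ih =>
    have ht : ∃ u, toDiamond.symm (polynomial (MvPolynomial.X t)) = u * y := by
      rw [← RootedTree.graft_branches t, ← bPlus_toAlgebra, polynomial_bPlus,
        LinearEquiv.symm_apply_apply]
      exact exists_root _
    by_cases h0 : f = 0
    · subst h0; rwa [toAlgebra_cons, toAlgebra_zero, mul_one]
    · obtain ⟨u, hu⟩ := ht
      obtain ⟨v, hv⟩ := ih h0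
      rw [toAlgebra_cons, map_mul, mul_def, hu, hv, mul_y_dia_mul_y, ← add_mul, ← sub_mul]
      exact ⟨_, rfl⟩

/-- `M(ρ(f₁) ⊗ ρ(f₂))(a ⊗ b)`, linearly in `f₁ ⊗ f₂`. -/
noncomputable def conv (ρ : ForestAlgebra →ₗ[ℚ] Module.End ℚ Words) (a b : Words) :
    ForestAlgebra ⊗[ℚ] ForestAlgebra →ₗ[ℚ] Words :=
  LinearMap.mul' ℚ Words ∘ₗ LinearMap.applyₗ (a ⊗ₜ[ℚ] b) ∘ₗ
    TensorProduct.homTensorHomMap (RingHom.id ℚ) Words Words Words Words ∘ₗ TensorProduct.map ρ ρ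

theorem conv_tmul (ρ : ForestAlgebra →ₗ[ℚ] Module.End ℚ Words) (a b : Words)
    (f g : ForestAlgebra) : conv ρ a b (f ⊗ₜ g) = ρ f a * ρ g b := by
  simp [conv]

theorem conv_eq (ρ : ForestAlgebra →ₗ[ℚ] Module.End ℚ Words) (a b : Words)
    (T : ForestAlgebra ⊗[ℚ] ForestAlgebra) : conv ρ a b T = LinearMap.mul' ℚ Words
      (TensorProduct.homTensorHomMap (RingHom.id ℚ) Words Words Words Words
        (TensorProduct.map ρ ρ T) (a ⊗ₜ[ℚ] b)) := rfl

theorem conv_add_right (ρ : ForestAlgebra →ₗ[ℚ] Module.End ℚ Words) (a b c : Words) (T) :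
    conv ρ a (b + c) T = conv ρ a b T + conv ρ a c T := by
  simp [conv, TensorProduct.tmul_add]

theorem conv_smul_right (ρ : ForestAlgebra →ₗ[ℚ] Module.End ℚ Words) (r : ℚ) (a b : Words) (T) :
    conv ρ a (r • b) T = r • conv ρ a b T := by
  simp [conv]

theorem conv_mul_right (a b : Words) (S T : ForestAlgebra ⊗[ℚ] ForestAlgebra)
    (f : ForestAlgebra) (h : ∀ a b, treeAction f (a * b) = conv treeAction a b S) :
    conv treeAction a b (S * T) = treeAction f (conv treeAction a b T) := by
  induction T using TensorProduct.induction_on with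
  | zero => simp
  | tmul g₁ g₂ =>
    rw [conv_tmul, h]
    clear h
    induction S using TensorProduct.induction_on with
    | zero => simp
    | tmul f₁ f₂ =>
      rw [Algebra.TensorProduct.tmul_mul_tmul, conv_tmul, conv_tmul, treeAction_mul,
        treeAction_mul]
    | add A B hA hB => rw [add_mul, map_add, map_add, hA, hB]
  | add A B hA hB => rw [mul_add, map_add, map_add, map_add, hA, hB]

theorem conv_bPlus_mul_z (a b : Words) (T : ForestAlgebra ⊗[ℚ] ForestAlgebra) :
    conv treeAction a (b * z) T = conv treeAction a b T * z := by
  induction T using TensorProduct.induction_on with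
  | zero => simp
  | tmul f g => rw [conv_tmul, conv_tmul, treeAction_apply g, act_mul_z, mul_assoc]
  | add A B hA hB => rw [map_add, map_add, hA, hB, add_mul]

theorem conv_bPlus_mul_y (a b : Words) (T : ForestAlgebra ⊗[ℚ] ForestAlgebra) :
    conv treeAction a (b * y) (bPlus.lTensor ForestAlgebra T) =
      conv treeAction a b (bPlus.lTensor ForestAlgebra T) * y
        - root (conv treeAction a (b * x) T) := by
  induction T using TensorProduct.induction_on with
  | zero => simp
  | tmul f g =>
    rw [LinearMap.lTensor_tmul, conv_tmul, conv_tmul, conv_tmul, treeAction_apply (bPlus g),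
      polynomial_bPlus, LinearEquiv.symm_apply_apply, act_root_mul_y, root_mul, mul_sub, mul_assoc,
      treeAction_apply g]
    simp [treeAction_apply, const_act, const_x]
  | add A B hA hB => simp only [map_add, hA, hB, add_mul]; abel

theorem conv_bPlus_one (a : Words) (T : ForestAlgebra ⊗[ℚ] ForestAlgebra) :
    conv treeAction a 1 (bPlus.lTensor ForestAlgebra T) = 0 := by
  induction T using TensorProduct.induction_on with
  | zero => simp
  | tmul f g =>
    rw [LinearMap.lTensor_tmul, conv_tmul, treeAction_apply (bPlus g),
      polynomial_bPlus, LinearEquiv.symm_apply_apply, act_one, const_root]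
    simp
  | add A B hA hB => simp only [map_add, hA, hB, add_zero]

theorem treeAction_coproduct (f : Forest) (a b : Words) :
    treeAction f.toAlgebra (a * b) = conv treeAction a b (coproduct f.toAlgebra) := by
  suffices h : ∀ t : RootedTree, ∀ a b, treeAction (MvPolynomial.X t) (a * b) =
      conv treeAction a b (coproduct (MvPolynomial.X t)) by
    induction f using Multiset.induction generalizing a b with
    | empty => simp [toAlgebra_zero, treeAction_one, Algebra.TensorProduct.one_def, conv_tmul]
    | cons t f ih =>
      rw [toAlgebra_cons, map_mul RootedTreeMaps.coproduct, treeAction_mul, ih, conv_mul_right _ _ _ _ _ (h t)]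
  intro t
  induction t using RootedTree.induction_on with
  | h f hf =>
    have ih : ∀ a b, treeAction f.toAlgebra (a * b) =
        conv treeAction a b (coproduct f.toAlgebra) := by
      induction f using Multiset.induction with
      | empty => simp [toAlgebra_zero, treeAction_one, Algebra.TensorProduct.one_def, conv_tmul]
      | cons t f ih =>
        intro a b
        rw [toAlgebra_cons, map_mul RootedTreeMaps.coproduct, treeAction_mul, ih fun s hs => hf s (by simp [hs]),
          conv_mul_right _ _ _ _ _ (hf t (by simp))]
    intro a b
    rw [coproduct_graft, map_add, conv_tmul, treeAction_one, LinearMap.id_apply]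
    induction b using right_induction with
    | one => rw [conv_bPlus_one, mul_one, mul_one, add_zero]
    | hz b hb =>
      rw [conv_bPlus_mul_z, ← mul_assoc, treeAction_apply, act_mul_z, ← treeAction_apply, hb,
        add_mul, mul_assoc]
    | hy b hb =>
      rw [conv_bPlus_mul_y, ← ih, ← mul_assoc, ← mul_assoc, treeAction_apply,
        ← bPlus_toAlgebra, polynomial_bPlus, LinearEquiv.symm_apply_apply, act_root_mul_y]
      rw [treeAction_apply, ← bPlus_toAlgebra, polynomial_bPlus, LinearEquiv.symm_apply_apply] at hb
      rw [hb, treeAction_apply f.toAlgebra, add_mul, mul_assoc _ b y, mul_assoc a b x, add_sub_assoc]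
    | add b c hb hc => rw [mul_add, map_add, hb, hc, conv_add_right, mul_add]; abel
    | smul r b hb => rw [mul_smul_comm, map_smul, hb, conv_smul_right, mul_smul_comm, smul_add]

theorem isRootedTreeMap_treeAction : IsRootedTreeMap treeAction where
  one := treeAction_one
  dot_x := by rw [treeAction_apply, polynomial_dot, act_x]
  dot_y := by rw [treeAction_apply, polynomial_dot, act_y, const_y]; simp
  graft f hf := by
    obtain ⟨u, hu⟩ := polynomial_forest f hf
    have h : x + 2 * y = z + y := by rw [z, two_mul, add_assoc]
    refine ⟨x * u, ?_, ?_, ?_⟩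
    · rw [treeAction_apply, hu, act_x, mul_assoc]
    · rw [treeAction_apply, polynomial_bPlus, LinearEquiv.symm_apply_apply, act_x, hu, root_mul_y, h]
      simp only [mul_assoc]
    · rw [treeAction_apply, polynomial_bPlus, LinearEquiv.symm_apply_apply, act_y, const_root, hu,
        root_mul_y, h]
      simp only [mul_assoc, map_zero, zero_mul, zero_sub]
  mul g h v _ := treeAction_mul _ _ _
  coproduct f w v _ := treeAction_coproduct f w v

/-! ### Uniqueness of the rooted tree maps -/

/-- The number of vertices of a forest. -/
def Forest.degree (f : Forest) : ℕ := (f.map RootedTree.degree).sum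

theorem degree_zero : Forest.degree 0 = 0 := by simp [Forest.degree]

theorem degree_add (f g : Forest) : Forest.degree (f + g) = f.degree + g.degree := by
  simp [Forest.degree]

theorem degree_cons (t : RootedTree) (f : Forest) :
    Forest.degree (t ::ₘ f) = t.degree + f.degree := by
  simp [Forest.degree]

theorem degree_graft (f : Forest) : (RootedTree.graft f).degree = 1 + f.degree := by
  rw [RootedTree.degree_eq, RootedTree.branches_graft]; rfl

theorem degree_pos (f : Forest) (hf : f ≠ 0) : 0 < f.degree := by
  obtain ⟨t, ht⟩ := Multiset.exists_mem_of_ne_zero hf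
  obtain ⟨g, rfl⟩ := Multiset.exists_cons_of_mem ht
  rw [degree_cons, ← RootedTree.graft_branches t, degree_graft]
  omega

/-- The tensors of bidegree at most `(p, q)`. -/
noncomputable def bidegreeLE (p q : ℕ) : Submodule ℚ (ForestAlgebra ⊗[ℚ] ForestAlgebra) :=
  Submodule.span ℚ {T | ∃ g h : Forest, g.degree ≤ p ∧ h.degree ≤ q ∧
    g.toAlgebra ⊗ₜ[ℚ] h.toAlgebra = T}

theorem tmul_mem {p q : ℕ} {g h : Forest} (hg : g.degree ≤ p) (hh : h.degree ≤ q) :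
    g.toAlgebra ⊗ₜ[ℚ] h.toAlgebra ∈ bidegreeLE p q :=
  Submodule.subset_span ⟨g, h, hg, hh, rfl⟩

theorem mul_mem {p q r s p' q' : ℕ} {S T : ForestAlgebra ⊗[ℚ] ForestAlgebra}
    (hS : S ∈ bidegreeLE p q) (hT : T ∈ bidegreeLE r s) (hp : p + r ≤ p') (hq : q + s ≤ q') :
    S * T ∈ bidegreeLE p' q' := by
  have h : S * T ∈ bidegreeLE p q * bidegreeLE r s := Submodule.mul_mem_mul hS hT
  suffices hle : bidegreeLE p q * bidegreeLE r s ≤ bidegreeLE p' q' from hle h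
  rw [bidegreeLE, bidegreeLE, Submodule.span_mul_span, Submodule.span_le]
  rintro _ ⟨_, ⟨a, b, ha, hb, rfl⟩, _, ⟨c, d, hc, hd, rfl⟩, rfl⟩
  change a.toAlgebra ⊗ₜ[ℚ] b.toAlgebra * c.toAlgebra ⊗ₜ[ℚ] d.toAlgebra ∈ bidegreeLE p' q'
  rw [Algebra.TensorProduct.tmul_mul_tmul, ← toAlgebra_add, ← toAlgebra_add]
  exact tmul_mem (by rw [degree_add]; omega) (by rw [degree_add]; omega)

theorem lTensor_mem {p q : ℕ} {T : ForestAlgebra ⊗[ℚ] ForestAlgebra} (hT : T ∈ bidegreeLE p q) :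
    bPlus.lTensor ForestAlgebra T ∈ bidegreeLE p (q + 1) := by
  refine (?_ : bidegreeLE p q ≤ (bidegreeLE p (q + 1)).comap (bPlus.lTensor ForestAlgebra)) hT
  refine Submodule.span_le.2 ?_
  rintro _ ⟨a, b, ha, hb, rfl⟩
  change bPlus.lTensor ForestAlgebra (a.toAlgebra ⊗ₜ[ℚ] b.toAlgebra) ∈ bidegreeLE p (q + 1)
  have h : bPlus b.toAlgebra = Forest.toAlgebra {RootedTree.graft b} := by
    rw [bPlus_toAlgebra]; simp [Forest.toAlgebra]
  rw [LinearMap.lTensor_tmul, h]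
  refine tmul_mem ha ?_
  rw [← Multiset.cons_zero, degree_cons, degree_graft, degree_zero]
  omega

theorem bidegreeLE_mono {p q p' q' : ℕ} (hp : p ≤ p') (hq : q ≤ q') :
    bidegreeLE p q ≤ bidegreeLE p' q' :=
  Submodule.span_mono fun _ ⟨g, h, hg, hh, e⟩ => ⟨g, h, hg.trans hp, hh.trans hq, e⟩

theorem toAlgebra_singleton (t : RootedTree) : Forest.toAlgebra {t} = MvPolynomial.X t := by
  simp [Forest.toAlgebra]

theorem expand_product {A : Type*} [CommRing A] (P Q R S L M : A) :
    (P + Q + L) * (R + S + M) =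
      P * R + Q * S + (P * S + Q * R + P * M + Q * M + L * R + L * S + L * M) := by ring

theorem leading_of_trees (f : Forest) (hf : f ≠ 0)
    (hs : ∀ s ∈ f, ∃ L ∈ bidegreeLE (s.degree - 1) (s.degree - 1),
      coproduct (MvPolynomial.X s) = MvPolynomial.X s ⊗ₜ 1 + 1 ⊗ₜ MvPolynomial.X s + L) :
    ∃ L ∈ bidegreeLE (f.degree - 1) (f.degree - 1),
      coproduct f.toAlgebra = f.toAlgebra ⊗ₜ 1 + 1 ⊗ₜ f.toAlgebra + L := by
  induction f using Multiset.induction with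
  | empty => exact absurd rfl hf
  | cons t f ih =>
    obtain ⟨L, hL, eL⟩ := hs t (by simp)
    by_cases h0 : f = 0
    · subst h0
      rw [toAlgebra_cons, toAlgebra_zero, mul_one, degree_cons, degree_zero]
      exact ⟨L, hL, eL⟩
    · obtain ⟨M, hM, eM⟩ := ih h0 fun s h => hs s (by simp [h])
      rw [toAlgebra_cons, map_mul, eL, eM, degree_cons, expand_product,
        Algebra.TensorProduct.tmul_mul_tmul, Algebra.TensorProduct.tmul_mul_tmul, mul_one]
      have hf := degree_pos f h0
      have ht : 0 < t.degree := by
        rw [← RootedTree.graft_branches t, degree_graft]; omega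
      have h1 : MvPolynomial.X t ⊗ₜ[ℚ] (1 : ForestAlgebra) ∈ bidegreeLE t.degree 0 := by
        rw [← toAlgebra_singleton, ← toAlgebra_zero]
        exact tmul_mem (by simp [Forest.degree]) (by simp [Forest.degree])
      have h2 : (1 : ForestAlgebra) ⊗ₜ[ℚ] MvPolynomial.X t ∈ bidegreeLE 0 t.degree := by
        rw [← toAlgebra_singleton, ← toAlgebra_zero]
        exact tmul_mem (by simp [Forest.degree]) (by simp [Forest.degree])
      have h3 : Forest.toAlgebra f ⊗ₜ[ℚ] (1 : ForestAlgebra) ∈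
          bidegreeLE (Forest.degree f) 0 := by
        rw [← toAlgebra_zero]
        exact tmul_mem le_rfl (by simp [Forest.degree])
      have h4 : (1 : ForestAlgebra) ⊗ₜ[ℚ] Forest.toAlgebra f ∈
          bidegreeLE 0 (Forest.degree f) := by
        rw [← toAlgebra_zero]
        exact tmul_mem (by simp [Forest.degree]) le_rfl
      refine ⟨_, ?_, rfl⟩
      refine add_mem (add_mem (add_mem (add_mem (add_mem (add_mem ?_ ?_) ?_) ?_) ?_) ?_) ?_
      · exact mul_mem h1 h4 (by omega) (by omega)
      · exact mul_mem h2 h3 (by omega) (by omega)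
      · exact mul_mem h1 hM (by omega) (by omega)
      · exact mul_mem h2 hM (by omega) (by omega)
      · exact mul_mem hL h3 (by omega) (by omega)
      · exact mul_mem hL h4 (by omega) (by omega)
      · exact mul_mem hL hM (by omega) (by omega)

theorem coproduct_leading (f : Forest) (hf : f ≠ 0) :
    ∃ L ∈ bidegreeLE (f.degree - 1) (f.degree - 1),
      coproduct f.toAlgebra = f.toAlgebra ⊗ₜ 1 + 1 ⊗ₜ f.toAlgebra + L := by
  have key := leading_of_trees
  refine key f hf fun s hs => ?_
  clear hs hf f
  induction s using RootedTree.induction_on with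
  | h f hf =>
    rw [coproduct_graft, degree_graft]
    by_cases h0 : f = 0
    · subst h0
      refine ⟨0, zero_mem _, ?_⟩
      rw [← bPlus_toAlgebra, toAlgebra_zero, map_one coproduct, Algebra.TensorProduct.one_def,
        LinearMap.lTensor_tmul, add_zero]
    · obtain ⟨L, hL, e⟩ := key f h0 hf
      have hd := degree_pos f h0
      refine ⟨bPlus.lTensor ForestAlgebra (f.toAlgebra ⊗ₜ 1) + bPlus.lTensor ForestAlgebra L,
        add_mem ?_ ?_, ?_⟩
      · rw [← toAlgebra_zero]
        exact bidegreeLE_mono (by omega) (by omega)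
          (lTensor_mem (tmul_mem le_rfl degree_zero.le))
      · exact bidegreeLE_mono (by omega) (by omega) (lTensor_mem hL)
      · rw [e, map_add, map_add, LinearMap.lTensor_tmul _ _ 1 f.toAlgebra, bPlus_toAlgebra]
        abel

theorem conv_congr {ρ ρ' : ForestAlgebra →ₗ[ℚ] Module.End ℚ Words} {n : ℕ}
    (h : ∀ f : Forest, f.degree ≤ n → ρ f.toAlgebra = ρ' f.toAlgebra) (a b : Words)
    {T : ForestAlgebra ⊗[ℚ] ForestAlgebra} (hT : T ∈ bidegreeLE n n) :
    conv ρ a b T = conv ρ' a b T := by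
  induction hT using Submodule.span_induction with
  | mem T hT =>
    obtain ⟨g, k, hg, hk, rfl⟩ := hT
    rw [conv_tmul, conv_tmul, h g hg, h k hk]
  | zero => simp
  | add S T _ _ hS hT => rw [map_add, map_add, hS, hT]
  | smul c T _ hT => rw [map_smul, map_smul, hT]

theorem IsRootedTreeMap.unique {ρ ρ' : ForestAlgebra →ₗ[ℚ] Module.End ℚ Words}
    (hρ : IsRootedTreeMap ρ) (hρ' : IsRootedTreeMap ρ') : ρ = ρ' := by
  have hy0 : y ≠ 0 := FreeAlgebra.ι_ne_zero _
  suffices h : ∀ n, ∀ f : Forest, f.degree = n → ρ f.toAlgebra = ρ' f.toAlgebra by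
    refine LinearMap.ext fun a => ?_
    induction a using forest_induction with
    | h f => exact h _ f rfl
    | add a b ha hb => rw [map_add, map_add, ha, hb]
    | smul c a ha => rw [map_smul, map_smul, ha]
  intro n
  induction n using Nat.strong_induction_on with
  | _ n ih =>
    intro f hfn
    replace ih : ∀ g : Forest, g.degree < n → ρ g.toAlgebra = ρ' g.toAlgebra :=
      fun g hg => ih _ hg g rfl
    by_cases h0 : f = 0
    · rw [h0, toAlgebra_zero, hρ.one, hρ'.one]
    have hn : 0 < n := hfn ▸ degree_pos f h0
    have hv : ∀ v ∈ ({x, y} : Set Words), ρ f.toAlgebra v = ρ' f.toAlgebra v := by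
      intro v hv
      obtain ⟨t, ht⟩ := Multiset.exists_mem_of_ne_zero h0
      obtain ⟨g, rfl⟩ := Multiset.exists_cons_of_mem ht
      rw [degree_cons] at hfn
      by_cases hg : g = 0
      · subst hg
        rw [toAlgebra_cons, toAlgebra_zero, mul_one]
        rw [degree_zero, add_zero, ← RootedTree.graft_branches t, degree_graft] at hfn
        rw [← RootedTree.graft_branches t]
        generalize t.branches = k at hfn
        by_cases hk : k = 0
        · subst hk
          change ρ dot v = ρ' dot v
          rcases hv with rfl | rfl
          · rw [hρ.dot_x, hρ'.dot_x]
          · rw [hρ.dot_y, hρ'.dot_y]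
        · rw [← bPlus_toAlgebra]
          obtain ⟨u, hu, hux, huy⟩ := hρ.graft k hk
          obtain ⟨u', hu', hux', huy'⟩ := hρ'.graft k hk
          rw [ih k (by omega), hu'] at hu
          obtain rfl := mul_right_cancel₀ hy0 hu
          rcases hv with rfl | rfl
          · rw [hux, hux']
          · rw [huy, huy']
      · have hg' := degree_pos g hg
        have ht' : 0 < t.degree := by
          rw [← RootedTree.graft_branches t, degree_graft]; omega
        rw [toAlgebra_cons, ← toAlgebra_singleton, hρ.mul _ _ v hv, hρ'.mul _ _ v hv,
          ih g (by omega), ih {t} (by simp [Forest.degree]; omega)]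
    obtain ⟨L, hL, eL⟩ := coproduct_leading f h0
    have step : ∀ ρ : ForestAlgebra →ₗ[ℚ] Module.End ℚ Words, IsRootedTreeMap ρ →
        ∀ w, ∀ v ∈ ({x, y} : Set Words), ρ f.toAlgebra (w * v) =
          ρ f.toAlgebra w * v + w * ρ f.toAlgebra v + conv ρ w v L := by
      intro ρ hρ w v hv
      rw [hρ.coproduct f w v hv, ← conv_eq, eL, map_add, map_add, conv_tmul, conv_tmul, hρ.one]
      rfl
    have hL' : ∀ w v, conv ρ w v L = conv ρ' w v L := fun w v =>
      conv_congr (fun g hg => ih g (by omega)) w v hL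
    have hstep : ∀ w, ρ f.toAlgebra w = ρ' f.toAlgebra w → ∀ v ∈ ({x, y} : Set Words),
        ρ f.toAlgebra (w * v) = ρ' f.toAlgebra (w * v) := by
      intro w hw v hv'
      rw [step ρ hρ w v hv', step ρ' hρ' w v hv', hw, hv v hv', hL']
    refine LinearMap.ext fun w => ?_
    induction w using right_induction with
    | one =>
      have hy : y ∈ ({x, y} : Set Words) := by simp
      have h1 := step ρ hρ 1 y hy
      have h2 := step ρ' hρ' 1 y hy
      rw [one_mul, one_mul, hv y hy, hL'] at h1
      rw [one_mul, one_mul] at h2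
      have h3 := h1.symm.trans h2
      exact mul_right_cancel₀ hy0 (add_right_cancel (add_right_cancel h3))
    | hz a ha =>
      rw [z, mul_add, map_add, map_add, hstep a ha x (by simp), hstep a ha y (by simp)]
    | hy a ha => exact hstep a ha y (by simp)
    | add a b ha hb => rw [map_add, map_add, ha, hb]
    | smul c a ha => rw [map_smul, map_smul, ha]

theorem existsUnique_isRootedTreeMap :
    ∃! ρ : ForestAlgebra →ₗ[ℚ] Module.End ℚ Words, IsRootedTreeMap ρ :=
  ⟨treeAction, isRootedTreeMap_treeAction, fun _ h => h.unique isRootedTreeMap_treeAction⟩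

/-- The map `ρ` that assigns to an element `f` of the forest algebra the rooted tree map `f̃`: the
unique linear map that satisfies the defining conditions. -/
noncomputable def rootedTreeMap : ForestAlgebra →ₗ[ℚ] Module.End ℚ Words :=
  existsUnique_isRootedTreeMap.choose

theorem isRootedTreeMap_rootedTreeMap : IsRootedTreeMap rootedTreeMap :=
  existsUnique_isRootedTreeMap.choose_spec.1

theorem rootedTreeMap_eq : rootedTreeMap = treeAction :=
  isRootedTreeMap_rootedTreeMap.unique isRootedTreeMap_treeAction

/-- The sets `U₀ = {𝕀}` and `U_d = B₊(U_{d-1}) ∪ • U_{d-1}` for `d ≥ 1`. -/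
def specialForests : ℕ → Set ForestAlgebra
  | 0 => {1}
  | d + 1 => (fun f => bPlus f) '' specialForests d ∪ (fun f => dot * f) '' specialForests d

end RootedTreeMaps

namespace RootedTreeMaps

open Words

namespace Words

/-! By uniqueness, `rootedTreeMap` is `treeAction`, so ρ(f) is `act` applied to `polynomial f`. The
map `polynomial` is an algebra homomorphism into the polynomials with the product ⋄; it sends • to y
and turns B₊ into `root`, which maps u y to u (z + y) y, where z = x + y. Since `act u x = x * u`,
the map `act` is injective, and the theorem becomes a statement about polynomials: those attached to
the elements of the sets U_d must be independent and span the image of `polynomial`. Nonempty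
forests have polynomials in ℚ⟨x, y⟩ y.

For d ≥ 1 an element of U_d arises from • by d - 1 operations, each of them B₊ or multiplication by
•. A word of length d - 1 in z and y records them (in lists, `.x` stands for z, and the head is both
the last letter and the outermost operation). The polynomial of the forest with word w is E(w) y,
where E is the linear map `grow`. As the words form a basis of ℚ⟨x, y⟩, everything reduces to the
bijectivity of E.

E does not raise the degree, and the spaces of bounded degree are finite-dimensional, so it is
enough that E maps each of them onto itself (`exists_grow_eq`). To reach a z + b y as E(u z + v y),
compare the right coefficients of z and y and eliminate E(u). What remains is b - a = 2 r + h - g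
for r = E(v), with y ⋄ r = g z + h y. The lemma `exists_y_dia_eq` solves the family s = 2 c r + h -
c g for all c > 0: splitting off one more last letter gives the same equation in smaller degree with
2 c + 1 for c. Only c and 2 c + 1 are ever inverted, and both stay positive. -/

/-! ### The filtration of the polynomials by degree. -/

instance : Finite Letter :=
  Finite.of_injective (fun a : Letter => (Letter.casesOn a true false : Bool)) (by
    intro a b h
    cases a <;> cases b <;> simp_all)

/-- The polynomials of degree at most `n`. -/
noncomputable def degreeLE (n : ℕ) : Submodule ℚ Words :=
  Submodule.span ℚ (basis '' {l | l.length ≤ n})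

/-- Needed to pass from surjectivity of `grow` on each piece to injectivity. -/
instance (n : ℕ) : FiniteDimensional ℚ (degreeLE n) :=
  FiniteDimensional.span_of_finite ℚ ((List.finite_length_le Letter n).image _)

theorem basis_mem_degreeLE {l : List Letter} {n : ℕ} (h : l.length ≤ n) :
    basis l ∈ degreeLE n :=
  Submodule.subset_span ⟨l, h, rfl⟩

theorem degreeLE_mono {m n : ℕ} (h : m ≤ n) : degreeLE m ≤ degreeLE n :=
  Submodule.span_mono (Set.image_mono fun _ hl => le_trans hl h)

theorem algebraMap_mem_degreeLE (c : ℚ) (n : ℕ) : algebraMap ℚ Words c ∈ degreeLE n := by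
  rw [Algebra.algebraMap_eq_smul_one, ← basis_nil]
  exact Submodule.smul_mem _ _ (basis_mem_degreeLE (by simp))

theorem mul_z_mem_degreeLE {a : Words} {n : ℕ} (h : a ∈ degreeLE n) :
    a * z ∈ degreeLE (n + 1) := by
  induction h using Submodule.span_induction with
  | mem a ha =>
    obtain ⟨l, hl, rfl⟩ := ha
    rw [← basis_x]
    exact basis_mem_degreeLE (Nat.succ_le_succ hl)
  | zero => simp
  | add a b _ _ ha hb => rw [add_mul]; exact add_mem ha hb
  | smul c a _ ha => rw [smul_mul_assoc]; exact Submodule.smul_mem _ _ ha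

theorem mul_y_mem_degreeLE {a : Words} {n : ℕ} (h : a ∈ degreeLE n) :
    a * y ∈ degreeLE (n + 1) := by
  induction h using Submodule.span_induction with
  | mem a ha =>
    obtain ⟨l, hl, rfl⟩ := ha
    rw [← basis_y]
    exact basis_mem_degreeLE (Nat.succ_le_succ hl)
  | zero => simp
  | add a b _ _ ha hb => rw [add_mul]; exact add_mem ha hb
  | smul c a _ ha => rw [smul_mul_assoc]; exact Submodule.smul_mem _ _ ha

theorem exists_mem_degreeLE (a : Words) : ∃ n, a ∈ degreeLE n := by
  induction a using word_induction with
  | h l => exact ⟨_, basis_mem_degreeLE le_rfl⟩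
  | add a b ha hb =>
    obtain ⟨m, hm⟩ := ha
    obtain ⟨n, hn⟩ := hb
    exact ⟨max m n, add_mem (degreeLE_mono (le_max_left m n) hm)
      (degreeLE_mono (le_max_right m n) hn)⟩
  | smul c a ha =>
    obtain ⟨n, hn⟩ := ha
    exact ⟨n, Submodule.smul_mem _ _ hn⟩

theorem exists_of_mem_degreeLE_zero {a : Words} (h : a ∈ degreeLE 0) :
    ∃ c : ℚ, a = algebraMap ℚ Words c := by
  induction h using Submodule.span_induction with
  | mem a ha =>
    obtain ⟨l, hl, rfl⟩ := ha
    obtain rfl : l = [] := by simpa using hl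
    exact ⟨1, by rw [basis_nil, map_one]⟩
  | zero => exact ⟨0, by simp⟩
  | add a b _ _ ha hb =>
    obtain ⟨c, rfl⟩ := ha
    obtain ⟨d, rfl⟩ := hb
    exact ⟨c + d, (map_add _ _ _).symm⟩
  | smul r a _ ha =>
    obtain ⟨c, rfl⟩ := ha
    exact ⟨r * c, by rw [map_mul, Algebra.smul_def]⟩

/-- Splitting off the last letter; this drives all the inductions on the degree below. Compared with
`exists_of_const`, it adds the degree bounds on both right quotients. -/
theorem exists_of_mem_degreeLE_succ {a : Words} {n : ℕ} (h : a ∈ degreeLE (n + 1)) :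
    ∃ c : ℚ, ∃ p ∈ degreeLE n, ∃ q ∈ degreeLE n,
      a = algebraMap ℚ Words c + p * z + q * y := by
  induction h using Submodule.span_induction with
  | mem a ha =>
    obtain ⟨l, hl, rfl⟩ := ha
    match l, hl with
    | [], _ => exact ⟨1, 0, zero_mem _, 0, zero_mem _, by simp [basis_nil]⟩
    | .x :: l, hl =>
      exact ⟨0, basis l, basis_mem_degreeLE (Nat.le_of_succ_le_succ hl), 0, zero_mem _,
        by simp [basis_x]⟩
    | .y :: l, hl =>
      exact ⟨0, 0, zero_mem _, basis l, basis_mem_degreeLE (Nat.le_of_succ_le_succ hl),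
        by simp [basis_y]⟩
  | zero => exact ⟨0, 0, zero_mem _, 0, zero_mem _, by simp⟩
  | add a b _ _ ha hb =>
    obtain ⟨c, p, hp, q, hq, rfl⟩ := ha
    obtain ⟨c', p', hp', q', hq', rfl⟩ := hb
    refine ⟨c + c', p + p', add_mem hp hp', q + q', add_mem hq hq', ?_⟩
    rw [map_add]; noncomm_ring
  | smul r a _ ha =>
    obtain ⟨c, p, hp, q, hq, rfl⟩ := ha
    refine ⟨r * c, r • p, Submodule.smul_mem _ _ hp, r • q, Submodule.smul_mem _ _ hq, ?_⟩
    rw [map_mul, smul_add, smul_add, Algebra.smul_def r (algebraMap ℚ Words c),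
      smul_mul_assoc, smul_mul_assoc]

/-! ### The operator y ⋄ and the linear equation behind surjectivity. -/

/-- The case v = 1 of the recursion for ⋄. The factor in brackets is what multiplication by • does
to a polynomial after its final y is removed, hence the clause for the letter y in `growWord`. -/
theorem y_dia_mul_y (w : Words) : dia y (w * y) = (w * y + dia y w - w * z) * y := by
  have h := mul_y_dia_mul_y 1 w
  rw [one_mul, one_dia, one_dia] at h
  rw [h, sub_mul, add_mul]

theorem y_dia_algebraMap (c : ℚ) : dia y (algebraMap ℚ Words c) = algebraMap ℚ Words c * y := by
  rw [Algebra.algebraMap_eq_smul_one, map_smul, dia_one, smul_mul_assoc, one_mul]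

theorem y_dia_mem_degreeLE {a : Words} {n : ℕ} (h : a ∈ degreeLE n) :
    dia y a ∈ degreeLE (n + 1) := by
  induction n generalizing a with
  | zero =>
    obtain ⟨c, rfl⟩ := exists_of_mem_degreeLE_zero h
    rw [y_dia_algebraMap]
    exact mul_y_mem_degreeLE h
  | succ n ih =>
    obtain ⟨c, p, hp, q, hq, rfl⟩ := exists_of_mem_degreeLE_succ h
    rw [map_add, map_add, y_dia_algebraMap, dia_mul_z, y_dia_mul_y]
    exact add_mem (add_mem (mul_y_mem_degreeLE (algebraMap_mem_degreeLE _ _))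
      (mul_z_mem_degreeLE (ih hp))) (mul_y_mem_degreeLE
        (sub_mem (add_mem (mul_y_mem_degreeLE hq) (ih hq)) (mul_z_mem_degreeLE hq)))

/-- The constant terms in `exists_y_dia_eq`: the equation (2 c + 1) k = κ. -/
theorem algebraMap_eq_smul_add {c : ℚ} (hc : 0 < c) (κ : ℚ) : algebraMap ℚ Words κ =
    (2 * c) • algebraMap ℚ Words (κ / (2 * c + 1)) + algebraMap ℚ Words (κ / (2 * c + 1)) := by
  rw [Algebra.smul_def, ← map_mul, ← map_add]
  congr 1
  field_simp

/-- Solvability of `s = 2 c r + h - c g` where `y ⋄ r = g z + h y`, for all `c > 0`. The induction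
on the degree replaces `c` by `2 c + 1`. -/
theorem exists_y_dia_eq {c : ℚ} (hc : 0 < c) {n : ℕ} {s : Words} (hs : s ∈ degreeLE n) :
    ∃ r ∈ degreeLE n, ∃ g ∈ degreeLE n, ∃ h : Words,
      dia y r = g * z + h * y ∧ s = (2 * c) • r + h - c • g := by
  induction n generalizing c s with
  | zero =>
    obtain ⟨κ, rfl⟩ := exists_of_mem_degreeLE_zero hs
    -- For a constant r = k one has y ⋄ r = k y, so g = 0 and h = k.
    refine ⟨algebraMap ℚ Words (κ / (2 * c + 1)), algebraMap_mem_degreeLE _ _, 0, zero_mem _,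
      algebraMap ℚ Words (κ / (2 * c + 1)), ?_, ?_⟩
    · rw [y_dia_algebraMap, zero_mul, zero_add]
    · rw [smul_zero, sub_zero]; exact algebraMap_eq_smul_add hc κ
  | succ n ih =>
    obtain ⟨κ, a, ha, b, hb, rfl⟩ := exists_of_mem_degreeLE_succ hs
    have hc' : 0 < 2 * c + 1 := by positivity
    -- Seek the solution as k + p z + q y and put r = q - c p, y ⋄ r = g z + h y. The coefficient of
    -- z gives 2 c p - q + g = a, that is, c p = a + r - g. The coefficient of y gives (2 c + 1) q +
    -- h = b. Substituting q = r + c p leaves b - (2 c + 1) a = 2 (2 c + 1) r + h - (2 c + 1) g.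
    obtain ⟨r, hr, g, hg, h, e₁, e₂⟩ := ih hc'
      (sub_mem hb (Submodule.smul_mem _ (2 * c + 1) ha))
    set k := algebraMap ℚ Words (κ / (2 * c + 1)) with hk
    obtain ⟨p, hp⟩ : ∃ p, p = c⁻¹ • (a + r - g) := ⟨_, rfl⟩
    have hpc : a = c • p - r + g := by
      rw [hp, smul_smul, mul_inv_cancel₀ hc.ne', one_smul]; abel
    have hpm : p ∈ degreeLE n := hp ▸ Submodule.smul_mem _ _ (sub_mem (add_mem ha hr) hg)
    have hqm : r + c • p ∈ degreeLE n := add_mem hr (Submodule.smul_mem _ _ hpm)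
    have hb' : b = (2 * (2 * c + 1)) • r + h - (2 * c + 1) • g + (2 * c + 1) • a := by
      rw [← e₂]; abel
    -- For this polynomial, y ⋄ has right z-coefficient y ⋄ p and right y-coefficient k + q y + y ⋄
    -- q - q z, with q = r + c p.
    refine ⟨k + p * z + (r + c • p) * y,
      add_mem (add_mem (algebraMap_mem_degreeLE _ _) (mul_z_mem_degreeLE hpm))
        (mul_y_mem_degreeLE hqm), dia y p, y_dia_mem_degreeLE hpm,
      k + ((r + c • p) * y + dia y (r + c • p) - (r + c • p) * z), ?_, ?_⟩
    · rw [map_add, map_add, hk, y_dia_algebraMap, dia_mul_z, y_dia_mul_y, ← hk, add_mul k]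
      abel
    · rw [algebraMap_eq_smul_add hc κ, ← hk, map_add, map_smul, e₁, hb', hpc]
      simp only [add_mul, sub_mul, smul_mul_assoc, smul_add, smul_sub]
      module

/-! ### The map E and its bijectivity. -/

/-- The values on words of the linear map `E` with `E(1) = 1`, `E(w z) = E(w) (z + y)` and
`E(w y) y = y ⋄ (E(w) y)`. -/
noncomputable def growWord : List Letter → Words
  | [] => 1
  | .x :: l => growWord l * (z + y)
  | .y :: l => growWord l * y + dia y (growWord l) - growWord l * z

/-- The linear map `E` with `E(1) = 1`, `E(w z) = E(w) (z + y)` and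
`E(w y) y = y ⋄ (E(w) y)`. -/
noncomputable def grow : Words →ₗ[ℚ] Words := basis.constr ℚ growWord

theorem grow_basis (l : List Letter) : grow (basis l) = growWord l := by
  rw [grow, Module.Basis.constr_basis]

theorem grow_algebraMap (c : ℚ) : grow (algebraMap ℚ Words c) = algebraMap ℚ Words c := by
  rw [Algebra.algebraMap_eq_smul_one, map_smul, ← basis_nil, grow_basis, growWord, basis_nil]

theorem grow_mul_z (a : Words) : grow (a * z) = grow a * (z + y) := by
  induction a using word_induction with
  | h l => rw [← basis_x, grow_basis, grow_basis, growWord]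
  | add a b ha hb => simp only [add_mul, map_add, ha, hb]
  | smul c a ha => simp only [smul_mul_assoc, map_smul, ha]

theorem grow_mul_y (a : Words) : grow (a * y) = grow a * y + dia y (grow a) - grow a * z := by
  induction a using word_induction with
  | h l => rw [← basis_y, grow_basis, grow_basis, growWord]
  | add a b ha hb => simp only [add_mul, map_add, ha, hb]; abel
  | smul c a ha => simp only [smul_mul_assoc, map_smul, ha, smul_add, smul_sub]

theorem grow_mem_degreeLE {a : Words} {n : ℕ} (h : a ∈ degreeLE n) : grow a ∈ degreeLE n := by
  induction n generalizing a with
  | zero =>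
    obtain ⟨c, rfl⟩ := exists_of_mem_degreeLE_zero h
    rwa [grow_algebraMap]
  | succ n ih =>
    obtain ⟨c, p, hp, q, hq, rfl⟩ := exists_of_mem_degreeLE_succ h
    rw [map_add, map_add, grow_algebraMap, grow_mul_z, grow_mul_y, mul_add]
    exact add_mem (add_mem (algebraMap_mem_degreeLE _ _)
      (add_mem (mul_z_mem_degreeLE (ih hp)) (mul_y_mem_degreeLE (ih hp))))
      (sub_mem (add_mem (mul_y_mem_degreeLE (ih hq)) (y_dia_mem_degreeLE (ih hq)))
        (mul_z_mem_degreeLE (ih hq)))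

/-- The degree bound on the preimage is essential: it makes E surjective on each finite-dimensional
piece, which injectivity relies on. -/
theorem exists_grow_eq {t : Words} {n : ℕ} (ht : t ∈ degreeLE n) :
    ∃ u ∈ degreeLE n, grow u = t := by
  induction n generalizing t with
  | zero =>
    obtain ⟨c, rfl⟩ := exists_of_mem_degreeLE_zero ht
    exact ⟨_, ht, grow_algebraMap c⟩
  | succ n ih =>
    obtain ⟨c, a, ha, b, hb, rfl⟩ := exists_of_mem_degreeLE_succ ht
    -- With r = E(v) and y ⋄ r = g z + h y, the coefficients of z and y in E(u z + v y) are E(u) + g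
    -- - r and E(u) + r + h. Equating them to a and b gives E(u) = a + r - g and b - a = 2 r + h -
    -- g, the case c = 1.
    obtain ⟨r, hr, g, hg, h, e₁, e₂⟩ := exists_y_dia_eq one_pos (sub_mem hb ha)
    obtain ⟨u, hu, eu⟩ := ih (sub_mem (add_mem ha hr) hg)
    obtain ⟨v, hv, ev⟩ := ih hr
    refine ⟨algebraMap ℚ Words c + u * z + v * y,
      add_mem (add_mem (algebraMap_mem_degreeLE _ _) (mul_z_mem_degreeLE hu))
        (mul_y_mem_degreeLE hv), ?_⟩
    have hb' : b = (2 * 1 : ℚ) • r + h - (1 : ℚ) • g + a := by rw [← e₂]; abel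
    rw [map_add, map_add, grow_algebraMap, grow_mul_z, grow_mul_y, eu, ev, e₁, hb', mul_one,
      two_smul, one_smul]
    noncomm_ring

theorem grow_surjective : Function.Surjective grow := fun t => by
  obtain ⟨n, hn⟩ := exists_mem_degreeLE t
  obtain ⟨u, -, hu⟩ := exists_grow_eq hn
  exact ⟨u, hu⟩

/-- Each element lies in some `degreeLE n`, a finite-dimensional space that E maps onto itself, so E
is injective there. -/
theorem grow_injective : Function.Injective grow := by
  refine (injective_iff_map_eq_zero grow).2 fun a ha => ?_
  obtain ⟨n, hn⟩ := exists_mem_degreeLE a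
  have hs : Function.Surjective (grow.restrict fun _ => grow_mem_degreeLE (n := n)) := by
    rintro ⟨t, ht⟩
    obtain ⟨u, hu, e⟩ := exists_grow_eq ht
    exact ⟨⟨u, hu⟩, Subtype.ext e⟩
  have hi := LinearMap.injective_iff_surjective.2 hs
  have h0 := (injective_iff_map_eq_zero _).1 hi ⟨a, hn⟩ (Subtype.ext ha)
  exact congrArg Subtype.val h0

/-! ### Independence of 1 and the polynomials E(w) y. -/

theorem act_injective : Function.Injective act := fun u v h => by
  have h' := LinearMap.congr_fun h x
  rw [act_x, act_x] at h'
  exact mul_left_cancel₀ (FreeAlgebra.ι_ne_zero _) h'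

theorem growWord_mul_y_linearIndependent :
    LinearIndependent ℚ fun l => growWord l * y := by
  have h : Function.Injective (LinearMap.mulRight ℚ y ∘ₗ grow) :=
    (mul_left_injective₀ (FreeAlgebra.ι_ne_zero _ : y ≠ 0)).comp grow_injective
  have he : (fun l => growWord l * y) = (LinearMap.mulRight ℚ y ∘ₗ grow) ∘ basis :=
    funext fun l => by simp [grow_basis]
  rw [he]
  exact basis.linearIndependent.map' _ (LinearMap.ker_eq_bot.2 h)

/-- Multiples of y have constant term zero. This separates the empty forest from all the other
members of the family. -/
theorem one_notMem_span_growWord_mul_y :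
    (1 : Words) ∉ Submodule.span ℚ (Set.range fun l => growWord l * y) := by
  intro h
  have hle : Submodule.span ℚ (Set.range fun l => growWord l * y) ≤
      LinearMap.ker const.toLinearMap := by
    rw [Submodule.span_le]
    rintro _ ⟨l, rfl⟩
    simp [const_y]
  simpa using hle h

end Words

/-! ### The sets U_d indexed by words. -/

/-- The elements of the sets `U_d` with `d ≥ 1`, indexed by the words of length `d - 1`. -/
noncomputable def specialForest : List Letter → ForestAlgebra
  | [] => dot
  | .x :: l => bPlus (specialForest l)
  | .y :: l => dot * specialForest l

/-- B₊ becomes `root` and multiplication by • becomes y ⋄; on polynomials ending in y these are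
exactly the two clauses that define E. -/
theorem polynomial_specialForest (l : List Letter) :
    toDiamond.symm (polynomial (specialForest l)) = growWord l * y := by
  induction l with
  | nil => rw [specialForest, polynomial_dot, growWord, one_mul]
  | cons a l ih =>
    cases a with
    | x =>
      rw [specialForest, polynomial_bPlus, LinearEquiv.symm_apply_apply, ih, root_mul_y, growWord]
    | y => rw [specialForest, map_mul, mul_def, polynomial_dot, ih, y_dia_mul_y, growWord]

theorem specialForests_succ (d : ℕ) :
    specialForests (d + 1) = specialForest '' {l | l.length = d} := by
  induction d with
  | zero =>
    -- Both operations send 𝕀 to •, so U₁ has a single element; hence words of length d index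
    -- U_{d+1}.
    have h : {l : List Letter | l.length = 0} = {[]} := by ext l; simp
    rw [h, Set.image_singleton, specialForest, specialForests, specialForests,
      Set.image_singleton, Set.image_singleton, ← dot_eq, mul_one, Set.union_self]
  | succ d ih =>
    rw [specialForests, ih]
    ext a
    constructor
    · rintro (⟨_, ⟨l, hl, rfl⟩, rfl⟩ | ⟨_, ⟨l, hl, rfl⟩, rfl⟩)
      · exact ⟨.x :: l, congrArg Nat.succ hl, rfl⟩
      · exact ⟨.y :: l, congrArg Nat.succ hl, rfl⟩
    · rintro ⟨l, hl, rfl⟩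
      match l, hl with
      | .x :: l, hl => exact Or.inl ⟨_, ⟨l, Nat.succ.inj hl, rfl⟩, rfl⟩
      | .y :: l, hl => exact Or.inr ⟨_, ⟨l, Nat.succ.inj hl, rfl⟩, rfl⟩

/-- The elements of all the sets `U_d`. -/
noncomputable def specialFamily (o : Option (List Letter)) : ForestAlgebra :=
  o.casesOn' 1 specialForest

theorem range_specialFamily : Set.range specialFamily = ⋃ d, specialForests d := by
  ext a
  rw [Set.mem_iUnion]
  constructor
  · rintro ⟨_ | l, rfl⟩
    · exact ⟨0, rfl⟩
    · exact ⟨l.length + 1, by rw [specialForests_succ]; exact ⟨l, rfl, rfl⟩⟩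
  · rintro ⟨_ | d, h⟩
    · exact ⟨none, h.symm⟩
    · rw [specialForests_succ] at h
      obtain ⟨l, -, rfl⟩ := h
      exact ⟨some l, rfl⟩

/-! ### The basis of the space of rooted tree maps. -/

theorem rootedTreeMap_specialFamily_linearIndependent :
    LinearIndependent ℚ fun o => rootedTreeMap (specialFamily o) := by
  have he : (fun o => rootedTreeMap (specialFamily o)) =
      act ∘ fun o : Option (List Letter) => o.casesOn' 1 fun l => growWord l * y := by
    funext o
    rw [rootedTreeMap_eq, treeAction_apply, Function.comp_apply]
    congr 1
    cases o with
    | none => simp [specialFamily, one_def]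
    | some l => simp [specialFamily, polynomial_specialForest]
  rw [he]
  exact (linearIndependent_option'.2 ⟨growWord_mul_y_linearIndependent,
    one_notMem_span_growWord_mul_y⟩).map' act (LinearMap.ker_eq_bot.2 act_injective)

/-- A linearly independent family has no repetitions, so distinct words already give distinct
forests; no combinatorics of trees is needed. -/
theorem specialFamily_injective : Function.Injective specialFamily := fun _ _ h =>
  rootedTreeMap_specialFamily_linearIndependent.injective (congrArg rootedTreeMap h)

theorem range_rootedTreeMap_eq_span : LinearMap.range rootedTreeMap =
    Submodule.span ℚ (Set.range fun o => rootedTreeMap (specialFamily o)) := by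
  refine le_antisymm ?_ (Submodule.span_le.2 ?_)
  · rintro _ ⟨a, rfl⟩
    induction a using forest_induction with
    | h f =>
      by_cases hf : f = 0
      · subst hf
        exact Submodule.subset_span ⟨none, by rw [toAlgebra_zero]; rfl⟩
      · obtain ⟨u, hu⟩ := polynomial_forest f hf
        -- The polynomial of a nonempty forest is u y; writing u = E(w) and expanding w in words
        -- expresses it through the polynomials of special forests.
        obtain ⟨w, rfl⟩ := grow_surjective u
        rw [rootedTreeMap_eq, treeAction_apply, hu]
        clear hu
        induction w using word_induction with
        | h l =>
          refine Submodule.subset_span ⟨some l, ?_⟩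
          rw [grow_basis, ← polynomial_specialForest]
          rfl
        | add a b ha hb => rw [map_add, add_mul, map_add]; exact add_mem ha hb
        | smul c a ha =>
          rw [map_smul, smul_mul_assoc, map_smul]; exact Submodule.smul_mem _ _ ha
    | add a b ha hb => rw [map_add]; exact add_mem ha hb
    | smul c a ha => rw [map_smul]; exact Submodule.smul_mem _ _ ha
  · rintro _ ⟨o, rfl⟩
    exact ⟨_, rfl⟩

/-- By injectivity an element determines its index, and the index determines d: `none` for d = 0, a
word of length d - 1 otherwise. -/
theorem specialForests_pairwise_disjoint :
    Pairwise fun d e : ℕ => Disjoint (specialForests d) (specialForests e) := by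
  have h0 : ∀ d, Disjoint (specialForests 0) (specialForests (d + 1)) := by
    intro d
    rw [specialForests_succ, specialForests, Set.disjoint_singleton_left]
    rintro ⟨l, -, h⟩
    exact Option.some_ne_none l (specialFamily_injective h)
  rintro (_ | d) (_ | e) hde
  · exact absurd rfl hde
  · exact h0 e
  · exact (h0 d).symm
  · rw [specialForests_succ, specialForests_succ, Set.disjoint_left]
    rintro _ ⟨l, hl, rfl⟩ ⟨m, hm, h⟩
    obtain rfl := Option.some.inj (@specialFamily_injective (some m) (some l) h)
    exact hde (congrArg (· + 1) (hl.symm.trans hm))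

/-- The basis of the space of rooted tree maps formed by the images of the sets `U_d`. -/
noncomputable def rootedTreeMapBasis :
    Module.Basis (⋃ d : ℕ, specialForests d) ℚ (LinearMap.range rootedTreeMap) :=
  ((Module.Basis.span rootedTreeMap_specialFamily_linearIndependent).map
    (LinearEquiv.ofEq _ _ range_rootedTreeMap_eq_span.symm)).reindex
    ((Equiv.ofInjective _ specialFamily_injective).trans (Equiv.setCongr range_specialFamily))

theorem coe_rootedTreeMapBasis (u : ⋃ d : ℕ, specialForests d) :
    (rootedTreeMapBasis u : Module.End ℚ Words) = rootedTreeMap u := by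
  obtain ⟨o, rfl⟩ := ((Equiv.ofInjective _ specialFamily_injective).trans
    (Equiv.setCongr range_specialFamily)).surjective u
  rw [rootedTreeMapBasis, Module.Basis.reindex_apply, Equiv.symm_apply_apply,
    Module.Basis.map_apply, LinearEquiv.coe_ofEq_apply, Module.Basis.span_apply]
  rfl

end RootedTreeMaps

/-- The sets `U_d` are pairwise disjoint, and the images under `ρ` of the elements of their union
form a basis of the space `Im ρ` of rooted tree maps: there is a basis of `Im ρ` indexed by
`⋃ d, U_d` whose member at `u` is `ρ(u)`. -/
theorem theorem3p1 :
    Pairwise (fun d e : ℕ => Disjoint (RootedTreeMaps.specialForests d)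
      (RootedTreeMaps.specialForests e)) ∧
    ∃ b : Module.Basis (⋃ d : ℕ, RootedTreeMaps.specialForests d) ℚ
        (LinearMap.range RootedTreeMaps.rootedTreeMap),
      ∀ u, ((b u : LinearMap.range RootedTreeMaps.rootedTreeMap) :
        Module.End ℚ RootedTreeMaps.Words) = RootedTreeMaps.rootedTreeMap u := by
  exact ⟨RootedTreeMaps.specialForests_pairwise_disjoint, RootedTreeMaps.rootedTreeMapBasis,
    RootedTreeMaps.coe_rootedTreeMapBasis⟩
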